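/- **Theorem (liveness of FnF-BFT).** Consider the FnF-BFT protocol with $n=3f+1$ replicas, of which at most $f$ are byzantine, and any number of clients, any of which may be byzantine, in the partially synchronous model: messages between correct replicas, and requests from correct clients to correct replicas, are delivered after finite delays, and within $\Delta>0$ from an unknown global stabilization time (GST) on (a message sent at time $t$ arrives by $\max(t,\mathrm{GST})+\Delta$). Channels are authenticated, signatures and $(2f+1,n)$ threshold signatures are unforgeable, hash functions are ideal, and local computation takes no time. Byzantine replicas behave arbitrarily subject to this. In the protocol, every replica acts as a leader for the hash buckets assigned to it in the current epoch, with linear prepare and commit phases in which the leader collects $2f+1$ partial signatures, per-leader checkpoints every $k\ge 1$ requests and watermarks of width $2k$. A replica calls an epoch-change when all requests assigned in the epoch are committed locally, when its epoch timer $T$ expires, when the no-progress timers $T_p$ of $2f+1$ leaders have expired (they are first set $5\Delta$ after the start of the epoch), or when $f+1$ other replicas call for higher epochs (it then joins the smallest of these). The epoch-change timer, of default value $T_e$ and doubled after $f$ consecutive unsuccessful epoch-changes, starts upon $2f+1$ epoch-change messages for that epoch or a higher one; on its expiry the next epoch-change is called. The primary collects $2f+1$ epoch-change messages, reliably broadcasts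 the configuration determined by them (loads $C_v\ge C_{\min}\ge 1$, sequence numbers, hanging requests) and sends the new-epoch message. A leader proposes the oldest uncommitted, non-pending request of its active buckets, and always has at least one fresh sequence number per epoch. Upon entering an epoch a replica asks the others for missing commit-certificates. Primaries follow the performance-based rotation with sliding window $g\ge n$, computed from a common (otherwise arbitrary) record of primary performance. The $m\cdot n$ buckets, $m\ge1$, are shared among the leaders according to their loads and rotated so that, however the loads develop, each leader serves each bucket infinitely often under each of at least $f+1$ distinct primaries. There is an absolute constant $\kappa>0$ such that, if the timers are configured with $T,T_e,T_p\ge\kappa\Delta$, the following holds in every execution: if a correct client broadcasts a request $r$ (at any time), then every correct replica eventually commits $r$, i.e. from some point on it holds a commit-certificate for $r$. -/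

import Mathlib

namespace FnF

noncomputable section

open scoped Classical

/-! ### Parameters -/

/-- The configuration of the protocol for `n = 3f+1` replicas, indexed by `Fin n`.
`perf e` is the number of requests that the common record of the replicas credits to the primary of
epoch `e`; `rot e C b` is the leader that serves bucket `b` in epoch `e` when the loads are `C`. -/
structure Protocol (Client : Type*) where
  f : ℕ
  /-- there are `m * n` hash buckets -/
  m : ℕ
  /-- checkpoint period -/
  k : ℕ
  /-- minimal number of requests assigned to a leader -/
  Cmin : ℕ
  /-- length of the sliding window of the primary rotation -/
  g : ℕ
  /-- bound on the message delay after stabilization -/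
  Δ : ℝ
  /-- epoch timer -/
  T : ℝ
  /-- default value of the epoch-change timer -/
  Te : ℝ
  /-- no-progress timer -/
  Tp : ℝ
  hash : Client → Fin (m * (3 * f + 1))
  perf : ℕ → ℕ
  rot : ℕ → (Fin (3 * f + 1) → ℕ) → Fin (m * (3 * f + 1)) → Fin (3 * f + 1)

/-! ### Primary rotation -/

/-- State of the primary rotation before an epoch: the last turn of each replica (`0` if none), and
the replicas of the current cycle that are still to be elected. -/
structure RotState (f : ℕ) where
  last : Fin (3 * f + 1) → ℕ
  rest : List (Fin (3 * f + 1))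

/-- The `2f+1` replicas with the best performance in their last turn (ties broken by identifier),
ordered by the time passed since that turn, longest first. -/
def bestPrimaries (f : ℕ) (perf : ℕ → ℕ) (s : RotState f) : List (Fin (3 * f + 1)) :=
  (((List.finRange (3 * f + 1)).mergeSort
      (fun u w => decide (perf (s.last w) ≤ perf (s.last u)))).take (2 * f + 1)).mergeSort
    (fun u w => decide (s.last u ≤ s.last w))

/-- The primary elected for epoch `e` and the remaining cycle.  The first `n` epochs explore the
replicas in the order of their identifiers.  Later, a replica whose last turn was in epoch `e - g` is
re-explored; otherwise the next one of the current cycle of best primaries is taken, a new cycle being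
determined when the old one is exhausted. -/
def elect (f g : ℕ) (perf : ℕ → ℕ) (e : ℕ) (s : RotState f) :
    Fin (3 * f + 1) × List (Fin (3 * f + 1)) :=
  if e ≤ 3 * f + 1 then (Fin.ofNat (3 * f + 1) (e - 1), [])
  else
    match (List.finRange (3 * f + 1)).find? (fun u => decide (s.last u + g = e)) with
    | some u => (u, s.rest)
    | none =>
      match (if s.rest = [] then bestPrimaries f perf s else s.rest) with
      | [] => (0, [])
      | u :: l => (u, l)

/-- State of the rotation before epoch `e + 1`; epochs are numbered from `1`. -/
def rotState (f g : ℕ) (perf : ℕ → ℕ) : ℕ → RotState f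
  | 0 => ⟨fun _ => 0, []⟩
  | e + 1 =>
    let s := rotState f g perf e
    let p := elect f g perf (e + 1) s
    ⟨Function.update s.last p.1 (e + 1), p.2⟩

/-- The primary of epoch `e`. -/
def primaryOf (f g : ℕ) (perf : ℕ → ℕ) (e : ℕ) : Fin (3 * f + 1) :=
  (elect f g perf e (rotState f g perf (e - 1))).1

/-! ### Bucket rotation -/

/-- `⌊C_v / ∑ C_u · (m-1) n⌋ + 1`. -/
def baseBuckets (f m : ℕ) (C : Fin (3 * f + 1) → ℕ) (v : Fin (3 * f + 1)) : ℕ :=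
  ⌊(C v : ℚ) / (∑ u, C u : ℕ) * (((m - 1) * (3 * f + 1) : ℕ) : ℚ)⌋₊ + 1

/-- The value by which the remaining buckets are handed out. -/
def bucketScore (f m : ℕ) (C : Fin (3 * f + 1) → ℕ) (v : Fin (3 * f + 1)) : ℚ :=
  (baseBuckets f m C v : ℚ) - (C v : ℚ) / (∑ u, C u : ℕ) * ((m * (3 * f + 1) : ℕ) : ℚ)

/-- `rot` is a bucket rotation for the sequence `p` of primaries: leader `v` gets
`baseBuckets v + δ_v` of the `m n` buckets with `δ_v ∈ {0,1}`, those with `δ_v = 1` being leaders of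
biggest score; and, however the loads develop, each leader repeatedly (that is, infinitely often)
serves each bucket under each of `f + 1` distinct primaries. -/
structure IsBucketRotation (f m : ℕ) (p : ℕ → Fin (3 * f + 1))
    (rot : ℕ → (Fin (3 * f + 1) → ℕ) → Fin (m * (3 * f + 1)) → Fin (3 * f + 1)) : Prop where
  shares : ∀ (e : ℕ) (C : Fin (3 * f + 1) → ℕ), (∀ v, 1 ≤ C v) →
    ∃ R : Finset (Fin (3 * f + 1)),
      (∀ v, (Finset.univ.filter (fun b => rot e C b = v)).card =
        baseBuckets f m C v + if v ∈ R then 1 else 0) ∧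
      ∀ u ∈ R, ∀ w ∉ R, bucketScore f m C w ≤ bucketScore f m C u
  rotates : ∀ C : ℕ → Fin (3 * f + 1) → ℕ, (∀ e v, 1 ≤ C e v) → ∀ v b,
    ∃ S : Finset (Fin (3 * f + 1)), f + 1 ≤ S.card ∧
      ∀ q ∈ S, ∃ᶠ e in Filter.atTop, p e = q ∧ rot e (C e) b = v

/-! Bucket rotations exist, whatever the performance of the primaries. -/

theorem rotState_succ (f g : ℕ) (perf : ℕ → ℕ) (e : ℕ) :
    (rotState f g perf (e + 1)).last =
      Function.update (rotState f g perf e).last (primaryOf f g perf (e + 1)) (e + 1) := rfl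

theorem primaryOf_last (f g : ℕ) (perf : ℕ → ℕ) (e : ℕ) (u : Fin (3 * f + 1)) :
    (rotState f g perf e).last u ≤ e ∧ ((rotState f g perf e).last u ≠ 0 →
      primaryOf f g perf ((rotState f g perf e).last u) = u) := by
  induction e with
  | zero => simp [rotState]
  | succ e ih =>
    rw [rotState_succ]
    by_cases h : u = primaryOf f g perf (e + 1)
    · rw [h]; simp
    · rw [Function.update_of_ne h]
      exact ⟨ih.1.trans (Nat.le_succ e), ih.2⟩

theorem last_initial (f g : ℕ) (perf : ℕ → ℕ) (e : ℕ) (he : e ≤ 3 * f + 1) (u : Fin (3 * f + 1)) :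
    (rotState f g perf e).last u = if (u : ℕ) < e then (u : ℕ) + 1 else 0 := by
  induction e with
  | zero => simp [rotState]
  | succ e ih =>
    have hp : primaryOf f g perf (e + 1) = ⟨e, by omega⟩ := by
      have : e % (3 * f + 1) = e := Nat.mod_eq_of_lt (by omega)
      simp [primaryOf, elect, he, Fin.ofNat, this]
    rw [rotState_succ, hp]
    by_cases h : u = ⟨e, by omega⟩
    · subst h; simp
    · rw [Function.update_of_ne h, ih (by omega)]
      have : (u : ℕ) ≠ e := fun h' => h (Fin.ext h')
      split_ifs <;> omega

theorem last_window (f g : ℕ) (perf : ℕ → ℕ) (hg : 3 * f + 1 ≤ g) (e : ℕ) (he : 3 * f + 1 ≤ e) :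
    Function.Injective (rotState f g perf e).last ∧
      ∀ u, e + 1 ≤ (rotState f g perf e).last u + g := by
  induction e, he using Nat.le_induction with
  | base =>
    have h : ∀ u, (rotState f g perf (3 * f + 1)).last u = (u : ℕ) + 1 := fun u => by
      rw [last_initial f g perf _ le_rfl, if_pos u.2]
    refine ⟨fun u w huw => ?_, fun u => ?_⟩
    · rw [h, h] at huw; exact Fin.ext (by omega)
    · rw [h]; omega
  | succ e he ih =>
    obtain ⟨hinj, hw⟩ := ih
    rw [rotState_succ]
    set s := rotState f g perf e with hs
    have hle : ∀ u, s.last u ≤ e := fun u => (primaryOf_last f g perf e u).1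
    set p := primaryOf f g perf (e + 1) with hp
    constructor
    · intro u w huw
      by_cases hu : u = p <;> by_cases hw' : w = p
      · rw [hu, hw']
      · rw [hu, Function.update_self, Function.update_of_ne hw'] at huw
        have := hle w; omega
      · rw [hw', Function.update_self, Function.update_of_ne hu] at huw
        have := hle u; omega
      · rw [Function.update_of_ne hu, Function.update_of_ne hw'] at huw
        exact hinj huw
    · intro u
      by_cases hu : u = p
      · rw [hu, Function.update_self]; omega
      · rw [Function.update_of_ne hu]
        have h1 := hw u
        by_contra hlt
        have heq : s.last u + g = e + 1 := by omega
        apply hu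
        have hfind : (List.finRange (3 * f + 1)).find? (fun w => decide (s.last w + g = e + 1)) =
            some u := by
          cases hc : (List.finRange (3 * f + 1)).find? (fun w => decide (s.last w + g = e + 1)) with
          | none =>
            have := List.find?_eq_none.1 hc u (List.mem_finRange u)
            simp [heq] at this
          | some w =>
            have := List.find?_some hc
            simp only [decide_eq_true_eq] at this
            rw [hinj (show s.last w = s.last u by omega)]
        have : ¬ e + 1 ≤ 3 * f + 1 := by omega
        rw [hp]
        simp only [primaryOf, elect, if_neg this, Nat.add_sub_cancel, ← hs, hfind]

theorem primaryOf_frequently (f g : ℕ) (perf : ℕ → ℕ) (hg : 3 * f + 1 ≤ g) (q : Fin (3 * f + 1)) :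
    ∃ᶠ e in Filter.atTop, primaryOf f g perf e = q := by
  rw [Filter.frequently_atTop]
  intro N
  have h := (last_window f g perf hg (N + g) (by omega)).2 q
  exact ⟨_, by omega, (primaryOf_last f g perf (N + g) q).2 (by omega)⟩

theorem exists_top {ι : Type*} [Fintype ι] (s : ι → ℚ) (r : ℕ) (hr : r ≤ Fintype.card ι) :
    ∃ R : Finset ι, R.card = r ∧ ∀ u ∈ R, ∀ w ∉ R, s w ≤ s u := by
  induction r with
  | zero => exact ⟨∅, by simp⟩
  | succ r ih =>
    obtain ⟨R, hR, h⟩ := ih (by omega)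
    have hne : (Finset.univ \ R).Nonempty := by
      rw [← Finset.card_pos, Finset.card_sdiff_of_subset (Finset.subset_univ R), Finset.card_univ]
      omega
    obtain ⟨x, hx, hmax⟩ := Finset.exists_max_image (Finset.univ \ R) s hne
    have hx' : x ∉ R := by simpa using hx
    refine ⟨insert x R, by rw [Finset.card_insert_of_notMem hx', hR], fun u hu w hw => ?_⟩
    rw [Finset.mem_insert, not_or] at hw
    rcases Finset.mem_insert.1 hu with rfl | hu
    · exact hmax w (by simp [hw.2])
    · exact h u hu w hw.2

theorem exists_fibers {ι β : Type*} [Fintype ι] [DecidableEq ι] [Fintype β] (t : ι → ℕ) (j : ι → β)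
    (hj : Function.Injective j) (ht : ∀ v, 1 ≤ t v) (hs : ∑ v, t v = Fintype.card β) :
    ∃ r : β → ι, (∀ v, r (j v) = v) ∧
      ∀ v, (Finset.univ.filter (fun b => r b = v)).card = t v := by
  have hcard : Fintype.card {b // b ∉ Set.range j} = Fintype.card (Σ v, Fin (t v - 1)) := by
    rw [Fintype.card_subtype_compl, Fintype.card_sigma]
    have h1 : Fintype.card {b // b ∈ Set.range j} = Fintype.card ι :=
      Fintype.card_congr (Equiv.ofInjective j hj).symm
    have h2 : ∑ v, t v = ∑ v, (t v - 1) + Fintype.card ι := by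
      rw [← Finset.card_univ, Finset.card_eq_sum_ones, ← Finset.sum_add_distrib]
      exact Finset.sum_congr rfl fun v _ => by have := ht v; omega
    simp only [Fintype.card_fin]
    rw [h1]; omega
  obtain ⟨φ⟩ := Fintype.card_eq.1 hcard
  let r : β → ι := fun b => if h : b ∈ Set.range j then h.choose else (φ ⟨b, h⟩).1
  have hr : ∀ v, r (j v) = v := fun v => by
    have h : j v ∈ Set.range j := ⟨v, rfl⟩
    simp only [r, dif_pos h]
    exact hj h.choose_spec
  refine ⟨r, hr, fun v => ?_⟩
  have hset : Finset.univ.filter (fun b => r b = v) =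
      insert (j v) (Finset.univ.image (fun i : Fin (t v - 1) => (φ.symm ⟨v, i⟩).1)) := by
    ext b
    simp only [Finset.mem_filter, Finset.mem_univ, true_and, Finset.mem_insert, Finset.mem_image]
    constructor
    · intro hb
      by_cases h : b ∈ Set.range j
      · obtain ⟨w, rfl⟩ := h
        rw [hr] at hb; subst hb; exact Or.inl rfl
      · right
        simp only [r, dif_neg h] at hb
        subst hb
        exact ⟨(φ ⟨b, h⟩).2, by simp⟩
    · rintro (rfl | ⟨i, rfl⟩)
      · exact hr v
      · have h := (φ.symm ⟨v, i⟩).2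
        simp only [r, dif_neg h]
        simp
  rw [hset, Finset.card_insert_of_notMem, Finset.card_image_of_injective]
  · simp only [Finset.card_univ, Fintype.card_fin]; have := ht v; omega
  · intro a b hab
    have := φ.symm.injective (Subtype.ext hab)
    simpa using this
  · simp only [Finset.mem_image, Finset.mem_univ, true_and, not_exists]
    intro i hi
    exact (φ.symm ⟨v, i⟩).2 ⟨v, hi.symm⟩

theorem exists_shares (f m : ℕ) (hm : 1 ≤ m) (C : Fin (3 * f + 1) → ℕ) (hC : ∀ v, 1 ≤ C v) :
    ∃ R : Finset (Fin (3 * f + 1)),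
      (∑ v, (baseBuckets f m C v + if v ∈ R then 1 else 0) = m * (3 * f + 1)) ∧
      ∀ u ∈ R, ∀ w ∉ R, bucketScore f m C w ≤ bucketScore f m C u := by
  set A : ℕ := (m - 1) * (3 * f + 1) with hA
  let x : Fin (3 * f + 1) → ℚ := fun v => (C v : ℚ) / (∑ u, C u : ℕ) * (A : ℚ)
  have hpos : (0 : ℚ) < ((∑ u, C u : ℕ) : ℚ) := by
    have : 0 < ∑ u, C u := Finset.sum_pos (fun v _ => hC v) Finset.univ_nonempty
    exact_mod_cast this
  have hx : ∀ v, 0 ≤ x v := fun v => by positivity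
  have hsum : ∑ v, x v = A := by
    rw [← Finset.sum_mul, ← Finset.sum_div]
    rw [← Nat.cast_sum, div_self hpos.ne', one_mul]
  have h1 : (∑ v, ⌊x v⌋₊ : ℕ) ≤ A := by
    have : ((∑ v, ⌊x v⌋₊ : ℕ) : ℚ) ≤ A := by
      rw [← hsum, Nat.cast_sum]
      exact Finset.sum_le_sum fun v _ => Nat.floor_le (hx v)
    exact_mod_cast this
  have h2 : A ≤ (∑ v, ⌊x v⌋₊ : ℕ) + (3 * f + 1) := by
    have : (A : ℚ) ≤ ((∑ v, ⌊x v⌋₊ + (3 * f + 1) : ℕ) : ℚ) := by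
      have h : ∑ v, x v ≤ ∑ v, ((⌊x v⌋₊ : ℚ) + 1) :=
        Finset.sum_le_sum fun v _ => (Nat.lt_floor_add_one (x v)).le
      rw [← hsum]
      refine h.trans (le_of_eq ?_)
      rw [Finset.sum_add_distrib]
      simp
    exact_mod_cast this
  have hb : ∑ v, baseBuckets f m C v = (∑ v, ⌊x v⌋₊ : ℕ) + (3 * f + 1) := by
    simp only [baseBuckets, Finset.sum_add_distrib]
    simp [x, hA]
  have hmn : m * (3 * f + 1) = A + (3 * f + 1) := by
    obtain ⟨m, rfl⟩ : ∃ m', m = m' + 1 := ⟨m - 1, by omega⟩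
    simp only [hA, Nat.add_sub_cancel]; ring
  obtain ⟨R, hR, htop⟩ := exists_top (bucketScore f m C) (A - ∑ v, ⌊x v⌋₊) (by simp; omega)
  refine ⟨R, ?_, htop⟩
  rw [Finset.sum_add_distrib, hb, Finset.sum_ite_mem, Finset.univ_inter, Finset.sum_const, hR, hmn]
  simp; omega

theorem exists_isBucketRotation (f m g : ℕ) (perf : ℕ → ℕ) (hm : 1 ≤ m) (hg : 3 * f + 1 ≤ g) :
    ∃ rot, IsBucketRotation f m (primaryOf f g perf) rot := by
  have hfreq := primaryOf_frequently f g perf hg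
  generalize primaryOf f g perf = p at hfreq ⊢
  have hmn : 3 * f + 1 ≤ m * (3 * f + 1) := Nat.le_mul_of_pos_left _ hm
  have hpos : 0 < m * (3 * f + 1) := by omega
  let s : ℕ → ℕ := fun e => Nat.count (fun e' => p e' = p e) e
  let j : ℕ → Fin (3 * f + 1) → Fin (m * (3 * f + 1)) := fun e v => ⟨(s e + v) % (m * (3 * f + 1)), Nat.mod_lt _ hpos⟩
  have hj : ∀ e, Function.Injective (j e) := fun e v w h => by
    have h' : (s e + v) % (m * (3 * f + 1)) = (s e + w) % (m * (3 * f + 1)) := congrArg Fin.val h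
    have h'' : (v : ℕ) ≡ w [MOD m * (3 * f + 1)] := Nat.ModEq.add_left_cancel' (s e) h'
    exact Fin.ext (Nat.ModEq.eq_of_lt_of_lt h'' (v.2.trans_le hmn) (w.2.trans_le hmn))
  have key : ∀ (e : ℕ) (C : Fin (3 * f + 1) → ℕ), ∃ r : Fin (m * (3 * f + 1)) → Fin (3 * f + 1), (∀ v, 1 ≤ C v) →
      (∀ v, r (j e v) = v) ∧ ∃ R : Finset (Fin (3 * f + 1)),
        (∀ v, (Finset.univ.filter (fun b => r b = v)).card =
          baseBuckets f m C v + if v ∈ R then 1 else 0) ∧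
        ∀ u ∈ R, ∀ w ∉ R, bucketScore f m C w ≤ bucketScore f m C u := by
    intro e C
    by_cases hC : ∀ v, 1 ≤ C v
    · obtain ⟨R, h1, h2⟩ := exists_shares f m hm C hC
      obtain ⟨r, hr1, hr2⟩ := exists_fibers
        (fun v => baseBuckets f m C v + if v ∈ R then 1 else 0) (j e) (hj e)
        (fun v => by simp only [baseBuckets]; omega) (by simpa using h1)
      exact ⟨r, fun _ => ⟨hr1, R, hr2, h2⟩⟩
    · exact ⟨fun _ => 0, fun h => absurd h hC⟩
  choose rot hrot using key
  refine ⟨rot, fun e C hC => (hrot e C hC).2, fun C hC v b => ⟨Finset.univ, by simp; omega, ?_⟩⟩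
  intro q _
  rw [Filter.frequently_atTop]
  intro N
  have hinf : {e | p e = q}.Infinite :=
    Nat.frequently_atTop_iff_infinite.1 (hfreq q)
  set c := b + m * (3 * f + 1) * (N + 1) - v with hc
  have hge : m * (3 * f + 1) * (N + 1) ≥ m * (3 * f + 1) + N := by nlinarith
  have hv := v.2
  have he : p (Nat.nth (fun e => p e = q) c) = q := Nat.nth_mem_of_infinite hinf c
  refine ⟨Nat.nth (fun e => p e = q) c, ?_, he, ?_⟩
  · have := (Nat.nth_strictMono hinf).le_apply (x := c)
    omega
  · have hs : s (Nat.nth (fun e => p e = q) c) = c := by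
      simp only [s, he]
      exact Nat.count_nth_of_infinite hinf c
    have : j (Nat.nth (fun e => p e = q) c) v = b := by
      apply Fin.ext
      simp only [j, hs]
      have : c + v = b + m * (3 * f + 1) * (N + 1) := by omega
      rw [this, Nat.add_mul_mod_self_left, Nat.mod_eq_of_lt b.2]
    rw [← this]
    exact (hrot _ _ (hC _)).1 v

variable {Client : Type*}

namespace Protocol

/-- The replicas. -/
abbrev Rep (P : Protocol Client) : Type := Fin (3 * P.f + 1)

/-- The hash buckets. -/
abbrev Bucket (P : Protocol Client) : Type := Fin (P.m * (3 * P.f + 1))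

/-- The primary of epoch `e`. -/
def primary (P : Protocol Client) (e : ℕ) : P.Rep := primaryOf P.f P.g P.perf e

/-- The standing requirements on the configuration. -/
structure WellFormed (P : Protocol Client) : Prop where
  m_pos : 1 ≤ P.m
  k_pos : 1 ≤ P.k
  Cmin_pos : 1 ≤ P.Cmin
  window : 3 * P.f + 1 ≤ P.g
  delta_pos : 0 < P.Δ
  rotation : IsBucketRotation P.f P.m P.primary P.rot

end Protocol

/-! ### Messages

Hash functions and signatures are ideal: a digest is represented by the value that it identifies, and
a combined signature by the statement that it certifies. -/

/-- A client request. -/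
structure Request (Client Op : Type*) where
  op : Op
  timestamp : ℕ
  client : Client

/-- The digest `h(sn ‖ e ‖ r)`; the value `none` is the null request. -/
structure Entry (Client Op : Type*) where
  epoch : ℕ
  sn : ℕ
  val : Option (Request Client Op)

/-- The configuration of an epoch, shared by reliable broadcast. -/
structure Config (P : Protocol Client) (Op : Type*) where
  /-- the replicas whose epoch-change messages were used -/
  callers : Finset P.Rep
  /-- the number `C_v(e)` of requests of each leader -/
  load : P.Rep → ℕ
  /-- the leader that serves a bucket -/
  bucket : P.Bucket → P.Rep
  /-- the sequence numbers led by each leader, in the order of the local sequence numbers -/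
  own : P.Rep → List ℕ
  /-- the value with which a hanging sequence number is proposed again -/
  hang : ℕ → Option (Option (Request Client Op))

/-- A checkpoint: the leader's requests of an epoch, with their sequence numbers, up to the local
sequence number `log.length`. -/
structure Ckpt (P : Protocol Client) (Op : Type*) where
  epoch : ℕ
  leader : P.Rep
  log : List (ℕ × Option (Request Client Op))

/-- An epoch-change message: stable checkpoints with their certificates, prepared-certificates and
commit-certificates, together with the configurations (certified by the reliable broadcast) to which
they refer. -/
structure EpochChange (P : Protocol Client) (Op : Type*) where
  sender : P.Rep
  epoch : ℕ
  configs : Finset (ℕ × Config P Op)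
  stable : Finset (Ckpt P Op)
  prepared : Finset (Entry Client Op)
  committed : Finset (Entry Client Op)

/-- The messages of the protocol.  `init`, `echo` and `ready` are the three phases of the reliable
broadcast; `fetch` and `supply` are used to obtain missing information from other replicas. -/
inductive Msg (P : Protocol Client) (Op : Type*)
  | request (r : Request Client Op)
  | prePrepare (d : Entry Client Op)
  | prepare (d : Entry Client Op)
  | preparedCert (d : Entry Client Op)
  | commit (d : Entry Client Op)
  | commitCert (d : Entry Client Op)
  | checkpoint (c : Ckpt P Op)
  | checkpointCert (c : Ckpt P Op)
  | epochChange (c : EpochChange P Op)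
  | init (e : ℕ) (cfg : Config P Op)
  | echo (e : ℕ) (cfg : Config P Op)
  | ready (e : ℕ) (cfg : Config P Op)
  | newEpoch (e : ℕ) (V : Finset (EpochChange P Op))
  | fetch (e : ℕ)
  | supply (ds : Finset (Entry Client Op))

variable {P : Protocol Client} {Op : Type*}

/-- The partially signed messages of other replicas that a message forwards. -/
def Msg.forwarded : Msg P Op → Set (P.Rep × Msg P Op)
  | .newEpoch _ V => {x | ∃ c ∈ V, x = (c.sender, .epochChange c)}
  | _ => ∅

/-- The statements for which an epoch-change message contains a combined signature. -/
def EpochChange.combined (c : EpochChange P Op) : Set (Msg P Op) :=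
  {s | (∃ x ∈ c.configs, s = .ready x.1 x.2) ∨ (∃ x ∈ c.stable, s = .checkpoint x) ∨
    (∃ d ∈ c.prepared, s = .prepare d) ∨ (∃ d ∈ c.committed, s = .commit d)}

/-- The statements for which a message contains a combined signature, each given as the message that
carries the partial signatures. -/
def Msg.combined : Msg P Op → Set (Msg P Op)
  | .preparedCert d => {.prepare d}
  | .commitCert d => {.commit d}
  | .checkpointCert c => {.checkpoint c}
  | .epochChange c => c.combined
  | .newEpoch _ V => {s | ∃ c ∈ V, s ∈ c.combined}
  | .supply ds => {s | ∃ d ∈ ds, s = .commit d}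
  | _ => ∅

/-- The client requests that a message introduces, signed by their clients. -/
def Msg.requests : Msg P Op → Set (Request Client Op)
  | .request r => {r}
  | .prePrepare d => {r | d.val = some r}
  | _ => ∅

/-! ### The configuration of a new epoch

It is computed from the set `V` of epoch-change messages used by the primary. -/

section NewConfig

/-- `sn` is settled: below a stable checkpoint, or covered by a commit-certificate. -/
def Settled (V : Finset (EpochChange P Op)) (sn : ℕ) : Prop :=
  (∃ c ∈ V, ∃ s ∈ c.stable, ∃ x, (sn, x) ∈ s.log) ∨ ∃ c ∈ V, ∃ d ∈ c.committed, d.sn = sn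

def preparedIn (V : Finset (EpochChange P Op)) : Finset (Entry Client Op) :=
  V.biUnion EpochChange.prepared

/-- `sn` belongs to a leader in the configuration `K` of some epoch, and a later sequence number of
that leader was prepared or committed in that epoch. -/
def InGap (K : Finset (ℕ × Config P Op)) (V : Finset (EpochChange P Op)) (sn : ℕ) : Prop :=
  ∃ x ∈ K, ∃ v, ∃ l₁ l₂, x.2.own v = l₁ ++ sn :: l₂ ∧
    ∃ d ∈ preparedIn V ∪ V.biUnion EpochChange.committed, d.epoch = x.1 ∧ d.sn ∈ l₂

/-- The value with which a hanging sequence number is proposed again: the value prepared in the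
highest epoch, or the null request in a gap. -/
def hangVal (K : Finset (ℕ × Config P Op)) (V : Finset (EpochChange P Op)) (sn : ℕ) :
    Option (Option (Request Client Op)) :=
  if Settled V sn then none
  else if h : ∃ d ∈ preparedIn V, d.sn = sn ∧
      ∀ d' ∈ preparedIn V, d'.sn = sn → d'.epoch ≤ d.epoch then
    some h.choose.val
  else if InGap K V sn then some none
  else none

/-- The last leader of `sn` according to the known configurations. -/
def lastLeader (K : Finset (ℕ × Config P Op)) (sn : ℕ) : P.Rep :=
  if h : ∃ v : P.Rep, ∃ x ∈ K, sn ∈ x.2.own v ∧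
      ∀ y ∈ K, (∃ w, sn ∈ y.2.own w) → y.1 ≤ x.1 then h.choose else 0

/-- The hanging sequence numbers. -/
def hangSns (K : Finset (ℕ × Config P Op)) (V : Finset (EpochChange P Op)) : Finset ℕ :=
  ((preparedIn V).image Entry.sn ∪
      K.biUnion (fun x => Finset.univ.biUnion (fun v => (x.2.own v).toFinset))).filter
    (fun sn => (hangVal K V sn).isSome)

/-- The number `c_v(e)` of requests committed under leader `v` in epoch `e`, according to `V`. -/
def committedUnder (K : Finset (ℕ × Config P Op)) (V : Finset (EpochChange P Op)) (e : ℕ)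
    (v : P.Rep) : ℕ :=
  (((K.filter (fun x => x.1 = e)).biUnion (fun x => (x.2.own v).toFinset)).filter (fun sn =>
    ∃ c ∈ V, (∃ d ∈ c.committed, d.epoch = e ∧ d.sn = sn) ∨
      ∃ s ∈ c.stable, s.epoch = e ∧ ∃ x, (sn, x) ∈ s.log)).card

/-- The number `C_v(e)` of requests assigned to leader `v` in epoch `e`. -/
def loadOf (K : Finset (ℕ × Config P Op)) (V : Finset (EpochChange P Op)) : ℕ → P.Rep → ℕ
  | 0, _ => P.Cmin
  | 1, _ => P.Cmin
  | e + 2, v =>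
    if committedUnder K V (e + 1) v < loadOf K V (e + 1) v then
      max P.Cmin ((Finset.range (P.f + 1)).sup (fun i => committedUnder K V (e + 1 - i) v))
    else 2 * committedUnder K V (e + 1) v

/-- The configuration of epoch `e`, given the earlier configurations `K` and the epoch-change messages
`V`.  A hanging request is led by the leader that serves its bucket, a null request by the leader of
its sequence number.  Each leader leads first its `O_v` hanging sequence numbers and then `C_v - O_v`
fresh ones (at least one), assigned to the leaders one after the other from the available numbers. -/
def buildConfig (P : Protocol Client) (Op : Type*) (e : ℕ) (K : Finset (ℕ × Config P Op))
    (V : Finset (EpochChange P Op)) : Config P Op :=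
  let C : P.Rep → ℕ := loadOf K V e
  let bucket : P.Bucket → P.Rep := P.rot e C
  let O : P.Rep → Finset ℕ := fun v => (hangSns K V).filter (fun sn =>
    ∃ x, hangVal K V sn = some x ∧
      (match x with
        | some r => bucket (P.hash r.client)
        | none => lastLeader K sn) = v)
  let fresh : P.Rep → ℕ := fun v => max 1 (C v - (O v).card)
  let Available : ℕ → Prop := fun sn => 1 ≤ sn ∧ ¬ Settled V sn ∧ hangVal K V sn = none
  { callers := V.image EpochChange.sender
    load := C
    bucket := bucket
    own := fun v => (O v).sort ++
      (List.range (fresh v)).map (fun i => Nat.nth Available (∑ w ∈ Finset.Iio v, fresh w + i))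
    hang := hangVal K V }

/-- The configuration of the first epoch. -/
def firstConfig (P : Protocol Client) (Op : Type*) : Config P Op := buildConfig P Op 1 ∅ ∅

/-- The configuration of epoch `e` determined by the epoch-change messages `V`. -/
def newConfig (P : Protocol Client) {Op : Type*} (e : ℕ) (V : Finset (EpochChange P Op)) :
    Config P Op :=
  buildConfig P Op e (insert (1, firstConfig P Op) (V.biUnion EpochChange.configs)) V

/-- `V` consists of `2f+1` epoch-change messages for epoch `e` from distinct replicas. -/
def ValidV (P : Protocol Client) {Op : Type*} (e : ℕ) (V : Finset (EpochChange P Op)) : Prop :=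
  V.card = 2 * P.f + 1 ∧ (∀ c ∈ V, c.epoch = e) ∧
    ∀ c ∈ V, ∀ c' ∈ V, c.sender = c'.sender → c = c'

end NewConfig

/-! ### Local state of a replica -/

structure RState (P : Protocol Client) (Op : Type*) where
  /-- the epoch entered or called for last -/
  epoch : ℕ
  /-- whether the replica has entered `epoch`; if not, it is in the epoch-change for `epoch` -/
  active : Prop
  /-- number of consecutive unsuccessful epoch-changes -/
  fails : ℕ
  /-- received messages with their senders (`none` stands for a client) -/
  inbox : Finset (Option P.Rep × Msg P Op)
  /-- client requests in the order of their arrival -/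
  queue : List (Request Client Op)
  /-- known commit-certificates -/
  certs : Finset (Entry Client Op)
  /-- prepared-certificates accepted in their epoch -/
  prepared : Finset (Entry Client Op)
  /-- stable checkpoints -/
  stable : Finset (Ckpt P Op)
  /-- configuration of the epoch entered last -/
  cfg : Config P Op
  /-- certified configurations of the entered epochs -/
  configs : Finset (ℕ × Config P Op)
  /-- pre-prepares accepted in the current epoch -/
  accepted : ℕ → Option (Option (Request Client Op))
  /-- own proposals as a leader in the current epoch -/
  proposed : ℕ → Option (Request Client Op)
  /-- the last epoch-change message sent -/
  call : Option (EpochChange P Op)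
  /-- as primary: the epoch-change messages selected for the current epoch -/
  selected : Option (Finset (EpochChange P Op))
  /-- configurations echoed and confirmed in the reliable broadcast for the current epoch -/
  echoed : Option (Config P Op)
  readied : Option (Config P Op)
  /-- commit-certificates supplied on demand -/
  supplied : Finset (P.Rep × Finset (Entry Client Op))
  /-- expiry times of the epoch timer, the epoch-change timer and the no-progress timers -/
  epochTimer : ℝ
  changeTimer : Option ℝ
  progressTimer : P.Rep → ℝ

/-- Replicas start in epoch `1` at time `0`. -/
def RState.start (P : Protocol Client) (Op : Type*) : RState P Op where
  epoch := 1
  active := True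
  fails := 0
  inbox := ∅
  queue := []
  certs := ∅
  prepared := ∅
  stable := ∅
  cfg := firstConfig P Op
  configs := ∅
  accepted := (firstConfig P Op).hang
  proposed := fun _ => none
  call := none
  selected := none
  echoed := none
  readied := none
  supplied := ∅
  epochTimer := P.T
  changeTimer := none
  progressTimer := fun _ => 5 * P.Δ + P.Tp

/-- The request `r` is committed locally: a commit-certificate for it is known. -/
def RState.HasCommitted (s : RState P Op) (r : Request Client Op) : Prop :=
  ∃ d ∈ s.certs, d.val = some r

/-- At least `q` replicas satisfy `S`. -/
def AtLeast (P : Protocol Client) (q : ℕ) (S : P.Rep → Prop) : Prop :=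
  ∃ W : Finset P.Rep, q ≤ W.card ∧ ∀ w ∈ W, S w

def RState.Got (s : RState P Op) (w : P.Rep) (m : Msg P Op) : Prop := (some w, m) ∈ s.inbox

/-- Low watermark of leader `v`: the local sequence number of its last stable checkpoint in the
current epoch. -/
def RState.low (s : RState P Op) (v : P.Rep) : ℕ :=
  (s.stable.filter (fun c => c.epoch = s.epoch ∧ c.leader = v)).sup (fun c => c.log.length)

/-- All requests assigned to `v` in the current epoch are committed locally. -/
def RState.Finished (s : RState P Op) (v : P.Rep) : Prop :=
  ∀ sn ∈ s.cfg.own v, ∃ x, (⟨s.epoch, sn, x⟩ : Entry Client Op) ∈ s.certs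

/-- The configuration `cfg` is delivered by the reliable broadcast for the current epoch. -/
def RState.Delivered (s : RState P Op) (cfg : Config P Op) : Prop :=
  AtLeast P (2 * P.f + 1) (fun w => s.Got w (.ready s.epoch cfg))

/-! ### Sending messages -/

/-- `s.Sends u w m`: in state `s`, replica `u` is bound to send `m` to `w` (once).  Replicas also send
messages to themselves, so that the own contribution counts towards the quorums. -/
inductive RState.Sends (s : RState P Op) (u : P.Rep) : P.Rep → Msg P Op → Prop
  /-- as leader: pre-prepare -/
  | prePrepare (w : P.Rep) (sn : ℕ) (r : Request Client Op) :
      s.active → s.proposed sn = some r → Sends s u w (.prePrepare ⟨s.epoch, sn, some r⟩)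
  /-- as backup: prepare, sent to the leader of the sequence number -/
  | prepare (w : P.Rep) (sn : ℕ) (x : Option (Request Client Op)) :
      s.active → s.accepted sn = some x → sn ∈ s.cfg.own w →
      Sends s u w (.prepare ⟨s.epoch, sn, x⟩)
  /-- as leader: prepared-certificate -/
  | preparedCert (w : P.Rep) (d : Entry Client Op) :
      s.active → d.epoch = s.epoch → d.sn ∈ s.cfg.own u → s.accepted d.sn = some d.val →
      AtLeast P (2 * P.f + 1) (fun x => s.Got x (.prepare d)) → Sends s u w (.preparedCert d)
  /-- as backup: commit -/
  | commit (w : P.Rep) (d : Entry Client Op) :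
      s.active → d.epoch = s.epoch → d ∈ s.prepared → d.sn ∈ s.cfg.own w →
      Sends s u w (.commit d)
  /-- as leader: commit-certificate -/
  | commitCert (w : P.Rep) (d : Entry Client Op) :
      s.active → d.epoch = s.epoch → d.sn ∈ s.cfg.own u →
      AtLeast P (2 * P.f + 1) (fun x => s.Got x (.commit d)) → Sends s u w (.commitCert d)
  /-- as backup: checkpoint, after delivering in order the leader's requests up to a local sequence
  number divisible by `k` -/
  | checkpoint (c : Ckpt P Op) :
      s.active → c.epoch = s.epoch → c.log ≠ [] → P.k ∣ c.log.length →
      List.Forall₂ (fun sn y => y.1 = sn ∧ (⟨s.epoch, sn, y.2⟩ : Entry Client Op) ∈ s.certs)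
        ((s.cfg.own c.leader).take c.log.length) c.log →
      Sends s u c.leader (.checkpoint c)
  /-- as leader: checkpoint-certificate -/
  | checkpointCert (w : P.Rep) (c : Ckpt P Op) :
      s.active → c.epoch = s.epoch → c.leader = u →
      AtLeast P (2 * P.f + 1) (fun x => s.Got x (.checkpoint c)) → Sends s u w (.checkpointCert c)
  | epochChange (w : P.Rep) (c : EpochChange P Op) :
      s.call = some c → Sends s u w (.epochChange c)
  /-- as primary: start of the reliable broadcast -/
  | init (w : P.Rep) (V : Finset (EpochChange P Op)) :
      s.selected = some V → Sends s u w (.init s.epoch (newConfig P s.epoch V))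
  | echo (w : P.Rep) (cfg : Config P Op) : s.echoed = some cfg → Sends s u w (.echo s.epoch cfg)
  | ready (w : P.Rep) (cfg : Config P Op) : s.readied = some cfg → Sends s u w (.ready s.epoch cfg)
  /-- as primary: new-epoch, after the reliable broadcast -/
  | newEpoch (w : P.Rep) (V : Finset (EpochChange P Op)) :
      s.selected = some V → s.Delivered (newConfig P s.epoch V) →
      Sends s u w (.newEpoch s.epoch V)
  /-- upon entering a new epoch: ask for missing information -/
  | fetch (w : P.Rep) : s.active → 2 ≤ s.epoch → Sends s u w (.fetch s.epoch)
  | supply (w : P.Rep) (ds : Finset (Entry Client Op)) :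
      (w, ds) ∈ s.supplied → Sends s u w (.supply ds)

/-! ### Reaction to a received message -/

/-- The state after receiving `m` from `src` at time `t`.  A commit-certificate from leader `v` resets
the no-progress timer of `v` unless the requests of `v` were already finished; the no-progress timers
are set for the first time `5Δ` after the start of the epoch. -/
def RState.receive (s : RState P Op) (t : ℝ) (src : Option P.Rep) (m : Msg P Op) : RState P Op :=
  let s₁ : RState P Op := { s with inbox := insert (src, m) s.inbox }
  match m with
  | .request r => { s₁ with queue := if r ∈ s.queue then s.queue else s.queue ++ [r] }
  | .commitCert d =>
    { s₁ with
      certs := insert d s.certs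
      progressTimer := fun v =>
        if s.active ∧ src = some v ∧ d.epoch = s.epoch ∧ d.sn ∈ s.cfg.own v ∧ ¬ s.Finished v then
          max (s.progressTimer v) (t + P.Tp)
        else s.progressTimer v }
  | .checkpointCert c => { s₁ with stable := insert c s.stable }
  | .fetch _ =>
    match src with
    | some w => { s₁ with supplied := insert (w, s.certs) s.supplied }
    | none => s₁
  | .supply ds => { s₁ with certs := s.certs ∪ ds }
  | _ => s₁

/-! ### Local actions -/

/-- The sequence number was already used in the current epoch, or hangs from an earlier one. -/
def RState.Used (s : RState P Op) (sn : ℕ) : Prop :=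
  s.cfg.hang sn ≠ none ∨ s.proposed sn ≠ none

/-- Leader `u` may propose `r`: it belongs to an active bucket of `u`, and it is neither committed nor
pending. -/
def RState.Eligible (s : RState P Op) (u : P.Rep) (r : Request Client Op) : Prop :=
  s.cfg.bucket (P.hash r.client) = u ∧ ¬ s.HasCommitted r ∧
    (∀ sn, s.cfg.hang sn ≠ some (some r)) ∧ ∀ sn, s.proposed sn ≠ some r

/-- The checkpoint information has settled the entry. -/
def RState.Covered (s : RState P Op) (d : Entry Client Op) : Prop :=
  ∃ c ∈ s.stable, ∃ x, (d.sn, x) ∈ c.log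

/-- Calling an epoch-change for epoch `e`: the replica stops participating in its previous epoch and
issues an epoch-change message. -/
def RState.callFor (s : RState P Op) (u : P.Rep) (e : ℕ) : RState P Op :=
  { s with
    epoch := e
    active := False
    fails := if s.active then 0 else s.fails + 1
    changeTimer := none
    accepted := fun _ => none
    proposed := fun _ => none
    selected := none
    echoed := none
    readied := none
    call := some
      { sender := u
        epoch := e
        configs := s.configs
        stable := s.stable
        prepared := s.prepared.filter
          (fun d => ¬ s.Covered d ∧ ¬ ∃ d' ∈ s.certs, d'.sn = d.sn)
        committed := s.certs.filter (fun d => ¬ s.Covered d) } }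

/-- Entering the epoch for which an epoch-change is in progress, at time `t`. -/
def RState.enter (s : RState P Op) (t : ℝ) (V : Finset (EpochChange P Op)) : RState P Op :=
  { s with
    active := True
    fails := 0
    certs := s.certs ∪ V.biUnion EpochChange.committed
    stable := s.stable ∪ V.biUnion EpochChange.stable
    cfg := newConfig P s.epoch V
    configs := insert (s.epoch, newConfig P s.epoch V) s.configs
    accepted := (newConfig P s.epoch V).hang
    proposed := fun _ => none
    epochTimer := t + P.T
    changeTimer := none
    progressTimer := fun _ => t + 5 * P.Δ + P.Tp }

/-- Value of the epoch-change timer: the default value, doubled for each unsuccessful consecutive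
epoch-change after the first `f` ones. -/
def changeTimeout (P : Protocol Client) (fails : ℕ) : ℝ :=
  if P.f ≤ fails then P.Te * 2 ^ (fails - P.f + 1) else P.Te

/-- Another replica `w` has called for epoch `e`. -/
def RState.CalledBy (s : RState P Op) (w : P.Rep) (e : ℕ) : Prop :=
  ∃ c, s.Got w (.epochChange c) ∧ c.sender = w ∧ c.epoch = e

/-- `RState.Act u t s s'`: at time `t`, replica `u` can perform a local action leading from `s` to
`s'`. -/
inductive RState.Act (u : P.Rep) (t : ℝ) (s : RState P Op) : RState P Op → Prop
  /-- as leader: propose the first eligible request with the next fresh sequence number, if that is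
  below the high watermark -/
  | propose (sn : ℕ) (r : Request Client Op) (l₁ l₂ : List ℕ) (q₁ q₂ : List (Request Client Op)) :
      s.active → s.cfg.own u = l₁ ++ sn :: l₂ → (∀ x ∈ l₁, s.Used x) → ¬ s.Used sn →
      l₁.length < s.low u + 2 * P.k →
      s.queue = q₁ ++ r :: q₂ → (∀ x ∈ q₁, ¬ s.Eligible u x) → s.Eligible u r →
      Act u t s { s with proposed := Function.update s.proposed sn (some r) }
  /-- accept a pre-prepare from the leader `v` of its sequence number, within the watermarks -/
  | acceptPrePrepare (v : P.Rep) (d : Entry Client Op) (r : Request Client Op) (l₁ l₂ : List ℕ) :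
      s.active → s.Got v (.prePrepare d) → d.epoch = s.epoch → s.accepted d.sn = none →
      s.cfg.own v = l₁ ++ d.sn :: l₂ → s.low v ≤ l₁.length →
      l₁.length < s.low v + 2 * P.k →
      d.val = some r → s.cfg.bucket (P.hash r.client) = v →
      Act u t s { s with accepted := Function.update s.accepted d.sn (some d.val) }
  /-- accept a prepared-certificate from the leader of its sequence number -/
  | acceptPrepared (v : P.Rep) (d : Entry Client Op) :
      s.active → s.Got v (.preparedCert d) → d.epoch = s.epoch → d.sn ∈ s.cfg.own v →
      d ∉ s.prepared → Act u t s { s with prepared := insert d s.prepared }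
  /-- call an epoch-change: all assigned requests are committed locally -/
  | callFinished : s.active → (∀ v, s.Finished v) → Act u t s (s.callFor u (s.epoch + 1))
  /-- call an epoch-change: the epoch timer has expired -/
  | callExpired : s.active → s.epochTimer ≤ t → Act u t s (s.callFor u (s.epoch + 1))
  /-- call an epoch-change: the no-progress timers of `2f+1` leaders have expired -/
  | callNoProgress : s.active → AtLeast P (2 * P.f + 1) (fun v => s.progressTimer v ≤ t) →
      Act u t s (s.callFor u (s.epoch + 1))
  /-- call an epoch-change: `f+1` other replicas call for higher epochs -/
  | callFollow (e : ℕ) :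
      AtLeast P (P.f + 1) (fun w => w ≠ u ∧ ∃ e', s.epoch < e' ∧ s.CalledBy w e') →
      IsLeast {e' | s.epoch < e' ∧ ∃ w, w ≠ u ∧ s.CalledBy w e'} e →
      Act u t s (s.callFor u e)
  /-- start the epoch-change timer upon `2f+1` epoch-change messages for the epoch or a higher one -/
  | startTimer : ¬ s.active → s.changeTimer = none →
      AtLeast P (2 * P.f + 1) (fun w => ∃ e', s.epoch ≤ e' ∧ s.CalledBy w e') →
      Act u t s { s with changeTimer := some (t + changeTimeout P s.fails) }
  /-- call the next epoch-change: the epoch-change timer has expired -/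
  | callNext (τ : ℝ) : ¬ s.active → s.changeTimer = some τ → τ ≤ t →
      Act u t s (s.callFor u (s.epoch + 1))
  /-- as primary: select the epoch-change messages, including the own one -/
  | select (V : Finset (EpochChange P Op)) :
      ¬ s.active → P.primary s.epoch = u → s.selected = none → ValidV P s.epoch V →
      (∀ c ∈ V, s.Got c.sender (.epochChange c)) → (∃ c ∈ V, c.sender = u) →
      Act u t s { s with selected := some V }
  | echo (cfg : Config P Op) : s.echoed = none →
      s.Got (P.primary s.epoch) (.init s.epoch cfg) → Act u t s { s with echoed := some cfg }
  | ready (cfg : Config P Op) : s.readied = none →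
      (AtLeast P (2 * P.f + 1) (fun w => s.Got w (.echo s.epoch cfg)) ∨
        AtLeast P (P.f + 1) (fun w => s.Got w (.ready s.epoch cfg))) →
      Act u t s { s with readied := some cfg }
  /-- accept a valid new-epoch message that matches the broadcast configuration -/
  | enter (V : Finset (EpochChange P Op)) : ¬ s.active →
      s.Got (P.primary s.epoch) (.newEpoch s.epoch V) → ValidV P s.epoch V →
      s.Delivered (newConfig P s.epoch V) → Act u t s (s.enter t V)

/-! ### Executions -/

inductive Event (P : Protocol Client) (Op : Type*)
  /-- the client of `r` broadcasts `r` -/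
  | submit (r : Request Client Op)
  /-- `m`, sent by `src` (`none` for a client), reaches `dst` -/
  | deliver (src : Option P.Rep) (dst : P.Rep) (m : Msg P Op)
  /-- replica `u` performs a local action -/
  | act (u : P.Rep)
  | idle

/-- An execution in the partially synchronous model, with byzantine replicas `byz` and correct clients
`good`.  Between `time i` and `time (i + 1)` the replicas are in the state `state i`; at
`time (i + 1)` the event `event i` leads to `state (i + 1)`.  Only the states of correct replicas are
meaningful. -/
structure Execution (P : Protocol Client) (Op : Type*) (byz : Finset P.Rep) (good : Set Client) where
  GST : ℝ
  time : ℕ → ℝ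
  event : ℕ → Event P Op
  state : ℕ → P.Rep → RState P Op
  time_zero : time 0 = 0
  time_mono : Monotone time
  time_unbounded : Filter.Tendsto time Filter.atTop Filter.atTop
  start : ∀ u, state 0 u = RState.start P Op
  /-- a received message changes the state of its recipient -/
  on_deliver : ∀ i src dst m, event i = .deliver src dst m →
    state (i + 1) dst = (state i dst).receive (time (i + 1)) src m ∧
      ∀ w, w ≠ dst → state (i + 1) w = state i w
  on_act : ∀ i u, event i = .act u →
    RState.Act u (time (i + 1)) (state i u) (state (i + 1) u) ∧
      ∀ w, w ≠ u → state (i + 1) w = state i w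
  on_other : ∀ i, (event i = .idle ∨ ∃ r, event i = .submit r) → state (i + 1) = state i
  /-- local actions take no time: an action of a correct replica that is possible is not delayed -/
  urgent : ∀ i t, time i ≤ t → t < time (i + 1) → ∀ u ∉ byz,
    ∀ s, ¬ RState.Act u t (state i u) s
  /-- a message that arrives from a correct replica was sent by it -/
  authentic : ∀ i w dst m, event i = .deliver (some w) dst m → w ∉ byz →
    ∃ j ≤ i, (state j w).Sends w dst m
  /-- clients send nothing but requests -/
  from_client : ∀ i dst m, event i = .deliver none dst m → ∃ r, m = .request r
  /-- requests of correct clients cannot be forged -/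
  request_authentic : ∀ i src dst m, event i = .deliver src dst m →
    (∀ w, src = some w → w ∈ byz) → ∀ r ∈ m.requests, r.client ∈ good →
    ∃ j < i, event j = .submit r
  /-- signatures of correct replicas cannot be forged: signed messages of correct replicas that a
  byzantine replica forwards were sent by them, and a combined signature needs `2f+1` replicas, of
  which the correct ones have sent their partial signatures -/
  unforgeable : ∀ i w dst m, event i = .deliver (some w) dst m → w ∈ byz →
    (∀ x ∈ m.forwarded, x.1 ∉ byz → ∃ j ≤ i, ∃ z, (state j x.1).Sends x.1 z x.2) ∧
    ∀ s ∈ m.combined, ∃ U : Finset P.Rep, U.card = 2 * P.f + 1 ∧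
      ∀ x ∈ U, x ∉ byz → ∃ j ≤ i, ∃ z, (state j x).Sends x z s
  /-- messages between correct replicas arrive, within `Δ` after stabilization -/
  network : ∀ j u w m, u ∉ byz → w ∉ byz → (state j u).Sends u w m →
    ∃ i, event i = .deliver (some u) w m ∧ time (i + 1) ≤ max (time j) GST + P.Δ
  /-- so do the requests of correct clients -/
  client_network : ∀ j r w, event j = .submit r → r.client ∈ good → w ∉ byz →
    ∃ i > j, event i = .deliver none w (.request r) ∧
      time (i + 1) ≤ max (time (j + 1)) GST + P.Δ

end

end FnF

namespace FnF

noncomputable section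

open scoped Classical

variable {Client : Type*} {P : Protocol Client} {Op : Type*}

/-! ### Configurations -/

section Config

variable (K : Finset (ℕ × Config P Op)) (V : Finset (EpochChange P Op))

theorem mem_hangSns {sn : ℕ} : sn ∈ hangSns K V ↔ hangVal K V sn ≠ none := by
  simp only [hangSns, Finset.mem_filter, Option.isSome_iff_ne_none]
  refine ⟨fun h => h.2, fun h => ⟨?_, h⟩⟩
  simp only [Finset.mem_union, Finset.mem_image, Finset.mem_biUnion, Finset.mem_univ, true_and,
    List.mem_toFinset]
  unfold hangVal at h
  split_ifs at h with h1 h2 h3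
  · exact absurd rfl h
  · obtain ⟨d, hd, hsn, -⟩ := h2
    exact Or.inl ⟨d, hd, hsn⟩
  · obtain ⟨x, hx, v, l₁, l₂, hl, -⟩ := h3
    exact Or.inr ⟨x, hx, v, by simp [hl]⟩
  · exact absurd rfl h

theorem finite_settled : {sn | Settled V sn}.Finite := by
  refine Set.Finite.subset (V.biUnion (fun c =>
    c.stable.biUnion (fun s => (s.log.map Prod.fst).toFinset) ∪
      c.committed.image Entry.sn)).finite_toSet ?_
  rintro sn (⟨c, hc, s, hs, x, hx⟩ | ⟨c, hc, d, hd, rfl⟩)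
  · simp only [Finset.coe_biUnion, Set.mem_iUnion, Finset.mem_coe]
    refine ⟨c, hc, Finset.mem_union_left _ ?_⟩
    simp only [Finset.mem_biUnion, List.mem_toFinset, List.mem_map]
    exact ⟨s, hs, _, hx, rfl⟩
  · simp only [Finset.coe_biUnion, Set.mem_iUnion, Finset.mem_coe]
    exact ⟨c, hc, Finset.mem_union_right _ (Finset.mem_image_of_mem _ hd)⟩

theorem infinite_available :
    {sn | 1 ≤ sn ∧ ¬ Settled V sn ∧ hangVal K V sn = none}.Infinite := by
  have h : ({0} ∪ {sn | Settled V sn} ∪ (hangSns K V : Set ℕ)).Finite :=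
    ((Set.finite_singleton 0).union (finite_settled V)).union (Finset.finite_toSet _)
  refine h.infinite_compl.mono fun sn hsn => ?_
  simp only [Set.mem_compl_iff, Set.mem_union, Set.mem_singleton_iff, Set.mem_ofPred_eq,
    Finset.mem_coe, mem_hangSns, not_or, not_not] at hsn
  exact ⟨Nat.one_le_iff_ne_zero.2 hsn.1.1, hsn.1.2, hsn.2⟩

theorem one_le_loadOf (hP : P.WellFormed) (e : ℕ) (v : P.Rep) : 1 ≤ loadOf K V e v := by
  induction e generalizing v with
  | zero => simpa [loadOf] using hP.Cmin_pos
  | succ e ih =>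
    cases e with
    | zero => simpa [loadOf] using hP.Cmin_pos
    | succ e =>
      rw [loadOf]
      split_ifs with h
      · exact hP.Cmin_pos.trans (le_max_left _ _)
      · have := ih v; omega

/-- The leader that proposes the hanging value `x` again. -/
def hangLeader (e : ℕ) (sn : ℕ) : Option (Request Client Op) → P.Rep
  | some r => P.rot e (loadOf K V e) (P.hash r.client)
  | none => lastLeader K sn

/-- The hanging sequence numbers led by `v`. -/
def hangOwn (e : ℕ) (v : P.Rep) : Finset ℕ :=
  (hangSns K V).filter (fun sn => ∃ x, hangVal K V sn = some x ∧ hangLeader K V e sn x = v)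

/-- The number of fresh sequence numbers led by `v`. -/
def freshCount (e : ℕ) (v : P.Rep) : ℕ := max 1 (loadOf K V e v - (hangOwn K V e v).card)

theorem buildConfig_own (e : ℕ) (v : P.Rep) :
    (buildConfig P Op e K V).own v = (hangOwn K V e v).sort ++
      (List.range (freshCount K V e v)).map (fun i =>
        Nat.nth (fun sn => 1 ≤ sn ∧ ¬ Settled V sn ∧ hangVal K V sn = none)
          (∑ w ∈ Finset.Iio v, freshCount K V e w + i)) := by
  have h : ∀ w, hangOwn K V e w = (hangSns K V).filter (fun sn =>
      ∃ x, hangVal K V sn = some x ∧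
        (match x with
          | some r => P.rot e (loadOf K V e) (P.hash r.client)
          | none => lastLeader K sn) = w) := fun w => by
    refine Finset.filter_congr fun sn _ => exists_congr fun x => ?_
    cases x <;> rfl
  simp only [freshCount, h]
  rfl

theorem buildConfig_own_unique (e : ℕ) {sn : ℕ} {v w : P.Rep}
    (hv : sn ∈ (buildConfig P Op e K V).own v) (hw : sn ∈ (buildConfig P Op e K V).own w) :
    v = w := by
  have hinf := infinite_available K V
  simp only [buildConfig_own, hangOwn, List.mem_append, Finset.mem_sort, Finset.mem_filter,
    List.mem_map, List.mem_range] at hv hw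
  have hnone : ∀ i, hangVal K V (Nat.nth (fun sn => 1 ≤ sn ∧ ¬ Settled V sn ∧
      hangVal K V sn = none) i) = none := fun i => (Nat.nth_mem_of_infinite hinf i).2.2
  have aux : ∀ (a b : P.Rep) (i j : ℕ), i < freshCount K V e a → a < b →
      ∑ x ∈ Finset.Iio a, freshCount K V e x + i <
        ∑ x ∈ Finset.Iio b, freshCount K V e x + j := by
    intro a b i j hi hab
    have h1 : ∑ x ∈ Finset.Iio a, freshCount K V e x + freshCount K V e a =
        ∑ x ∈ Finset.Iic a, freshCount K V e x := by
      rw [← Finset.Iio_insert, Finset.sum_insert (by simp), add_comm]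
    have h2 : ∑ x ∈ Finset.Iic a, freshCount K V e x ≤ ∑ x ∈ Finset.Iio b, freshCount K V e x :=
      Finset.sum_le_sum_of_subset fun x hx => by
        simp only [Finset.mem_Iic, Finset.mem_Iio] at hx ⊢; exact hx.trans_lt hab
    omega
  rcases hv with ⟨-, x, hx, rfl⟩ | ⟨i, hi, rfl⟩
  · rcases hw with ⟨-, y, hy, rfl⟩ | ⟨j, hj, rfl⟩
    · rw [hx, Option.some.injEq] at hy; rw [hy]
    · rw [hnone] at hx; cases hx
  · rcases hw with ⟨-, y, hy, rfl⟩ | ⟨j, hj, h⟩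
    · rw [hnone] at hy; cases hy
    · have := Nat.nth_injective hinf h
      rcases lt_trichotomy v w with hvw | hvw | hvw
      · have := aux v w i j hi hvw; omega
      · exact hvw
      · have := aux w v j i hj hvw; omega

theorem buildConfig_own_split (e : ℕ) (v : P.Rep) : ∃ l₁ sn l₂,
    (buildConfig P Op e K V).own v = l₁ ++ sn :: l₂ ∧
      (∀ x ∈ l₁, (buildConfig P Op e K V).hang x ≠ none) ∧
      (buildConfig P Op e K V).hang sn = none := by
  have hinf := infinite_available K V
  obtain ⟨k, hk⟩ : ∃ k, freshCount K V e v = k + 1 :=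
    ⟨freshCount K V e v - 1, by unfold freshCount; omega⟩
  rw [buildConfig_own, hk, List.range_succ_eq_map, List.map_cons]
  refine ⟨_, _, _, rfl, fun x hx => ?_, (Nat.nth_mem_of_infinite hinf _).2.2⟩
  rw [Finset.mem_sort, hangOwn, Finset.mem_filter] at hx
  obtain ⟨-, y, hy, -⟩ := hx
  simp [buildConfig, hy]

theorem buildConfig_hang_mem (e : ℕ) {sn : ℕ} {r : Request Client Op}
    (h : (buildConfig P Op e K V).hang sn = some (some r)) :
    sn ∈ (buildConfig P Op e K V).own ((buildConfig P Op e K V).bucket (P.hash r.client)) := by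
  rw [buildConfig_own, List.mem_append, Finset.mem_sort, hangOwn, Finset.mem_filter]
  replace h : hangVal K V sn = some (some r) := h
  exact Or.inl ⟨(mem_hangSns K V).2 (by simp [h]), some r, h, rfl⟩

end Config

/-- The properties of the configuration of epoch `e` that matter for progress. -/
structure Config.Sound (cfg : Config P Op) (e : ℕ) : Prop where
  own_unique : ∀ {sn v w}, sn ∈ cfg.own v → sn ∈ cfg.own w → v = w
  own_split : ∀ v, ∃ l₁ sn l₂, cfg.own v = l₁ ++ sn :: l₂ ∧ (∀ x ∈ l₁, cfg.hang x ≠ none) ∧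
    cfg.hang sn = none
  hang_mem : ∀ {sn r}, cfg.hang sn = some (some r) → sn ∈ cfg.own (cfg.bucket (P.hash r.client))
  bucket_eq : cfg.bucket = P.rot e cfg.load
  load_pos : P.WellFormed → ∀ v, 1 ≤ cfg.load v

theorem buildConfig_sound (e : ℕ) (K : Finset (ℕ × Config P Op)) (V : Finset (EpochChange P Op)) :
    (buildConfig P Op e K V).Sound e where
  own_unique := buildConfig_own_unique K V e
  own_split := buildConfig_own_split K V e
  hang_mem := buildConfig_hang_mem K V e
  bucket_eq := rfl
  load_pos hP v := one_le_loadOf K V hP e v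

theorem newConfig_sound (e : ℕ) (V : Finset (EpochChange P Op)) : (newConfig P e V).Sound e :=
  buildConfig_sound _ _ _

theorem AtLeast.mono {q q' : ℕ} {S S' : P.Rep → Prop} (hq : q' ≤ q) (h : AtLeast P q S)
    (hS : ∀ w, S w → S' w) : AtLeast P q' S' := by
  obtain ⟨W, hW, h⟩ := h
  exact ⟨W, hq.trans hW, fun w hw => hS w (h w hw)⟩

/-! ### Receiving a message -/

namespace RState

variable (s : RState P Op) (t : ℝ) (src : Option P.Rep) (m : Msg P Op)

@[simp] theorem receive_epoch : (s.receive t src m).epoch = s.epoch := by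
  cases m <;> cases src <;> rfl

@[simp] theorem receive_active : (s.receive t src m).active = s.active := by
  cases m <;> cases src <;> rfl

@[simp] theorem receive_prepared : (s.receive t src m).prepared = s.prepared := by
  cases m <;> cases src <;> rfl

@[simp] theorem receive_cfg : (s.receive t src m).cfg = s.cfg := by
  cases m <;> cases src <;> rfl

@[simp] theorem receive_accepted : (s.receive t src m).accepted = s.accepted := by
  cases m <;> cases src <;> rfl

@[simp] theorem receive_proposed : (s.receive t src m).proposed = s.proposed := by
  cases m <;> cases src <;> rfl

@[simp] theorem receive_call : (s.receive t src m).call = s.call := by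
  cases m <;> cases src <;> rfl

@[simp] theorem receive_selected : (s.receive t src m).selected = s.selected := by
  cases m <;> cases src <;> rfl

@[simp] theorem receive_echoed : (s.receive t src m).echoed = s.echoed := by
  cases m <;> cases src <;> rfl

@[simp] theorem receive_readied : (s.receive t src m).readied = s.readied := by
  cases m <;> cases src <;> rfl

@[simp] theorem receive_epochTimer : (s.receive t src m).epochTimer = s.epochTimer := by
  cases m <;> cases src <;> rfl

@[simp] theorem receive_changeTimer : (s.receive t src m).changeTimer = s.changeTimer := by
  cases m <;> cases src <;> rfl

@[simp] theorem receive_inbox : (s.receive t src m).inbox = insert (src, m) s.inbox := by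
  cases m <;> cases src <;> rfl

theorem le_receive_progressTimer (v : P.Rep) :
    s.progressTimer v ≤ (s.receive t src m).progressTimer v := by
  cases m <;> cases src <;> try exact le_rfl
  all_goals
    simp only [receive]
    split_ifs <;> first | exact le_max_left _ _ | exact le_rfl

theorem queue_prefix_receive : s.queue <+: (s.receive t src m).queue := by
  cases m <;> cases src <;> try exact List.prefix_rfl
  all_goals
    simp only [receive]
    split_ifs
    · exact List.prefix_rfl
    · exact List.prefix_append _ _

theorem certs_subset_receive : s.certs ⊆ (s.receive t src m).certs := by
  cases m <;> cases src <;> try exact subset_rfl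
  all_goals
    simp only [receive]
    first | exact Finset.subset_insert _ _ | exact Finset.subset_union_left

theorem stable_subset_receive : s.stable ⊆ (s.receive t src m).stable := by
  cases m <;> cases src <;> try exact subset_rfl
  all_goals exact Finset.subset_insert _ _

theorem supplied_subset_receive : s.supplied ⊆ (s.receive t src m).supplied := by
  cases m <;> cases src <;> try exact subset_rfl
  all_goals exact Finset.subset_insert _ _

theorem mem_receive_certs {d : Entry Client Op} (h : d ∈ (s.receive t src m).certs) :
    d ∈ s.certs ∨ m = .commitCert d ∨ ∃ ds, m = .supply ds ∧ d ∈ ds := by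
  cases m <;> cases src <;> try exact Or.inl h
  all_goals
    simp only [receive, Finset.mem_insert, Finset.mem_union] at h
    rcases h with h | h
    all_goals simp [h]

theorem mem_receive_stable {c : Ckpt P Op} (h : c ∈ (s.receive t src m).stable) :
    c ∈ s.stable ∨ m = .checkpointCert c := by
  cases m <;> cases src <;> try exact Or.inl h
  all_goals
    simp only [receive, Finset.mem_insert] at h
    rcases h with h | h
    all_goals simp [h]

theorem mem_receive_supplied {x : P.Rep × Finset (Entry Client Op)}
    (h : x ∈ (s.receive t src m).supplied) : x ∈ s.supplied ∨ x.2 = s.certs := by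
  cases m <;> cases src <;> try exact Or.inl h
  all_goals
    simp only [receive, Finset.mem_insert] at h
    rcases h with h | h
    all_goals simp [h]

/-! ### Evolution of the state of a replica -/

/-- What persists within an epoch. -/
structure SameEpoch (s s' : RState P Op) : Prop where
  call : s'.call = s.call
  selected : ∀ V, s.selected = some V → s'.selected = some V
  echoed : ∀ cfg, s.echoed = some cfg → s'.echoed = some cfg
  readied : ∀ cfg, s.readied = some cfg → s'.readied = some cfg
  active : s.active → s'.active
  cfg : s.active → s'.cfg = s.cfg
  accepted : s.active → ∀ sn x, s.accepted sn = some x → s'.accepted sn = some x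
  proposed : s.active → ∀ sn r, s.proposed sn = some r → s'.proposed sn = some r
  epochTimer : s.active → s'.epochTimer = s.epochTimer
  changeTimer : ∀ τ, s.changeTimer = some τ → s'.active ∨ s'.changeTimer = some τ

/-- What persists forever. -/
structure Evolves (s s' : RState P Op) : Prop where
  inbox : s.inbox ⊆ s'.inbox
  certs : s.certs ⊆ s'.certs
  stable : s.stable ⊆ s'.stable
  prepared : s.prepared ⊆ s'.prepared
  supplied : s.supplied ⊆ s'.supplied
  queue : s.queue <+: s'.queue
  epoch : s.epoch ≤ s'.epoch
  same : s'.epoch = s.epoch → SameEpoch s s'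

variable {s} {s' s'' : RState P Op}

theorem SameEpoch.refl (s : RState P Op) : SameEpoch s s :=
  ⟨rfl, fun _ => id, fun _ => id, fun _ => id, id, fun _ => rfl, fun _ _ _ => id, fun _ _ _ => id,
    fun _ => rfl, fun _ => Or.inr⟩

theorem SameEpoch.trans (h : SameEpoch s s') (h' : SameEpoch s' s'') : SameEpoch s s'' where
  call := h'.call.trans h.call
  selected V hV := h'.selected V (h.selected V hV)
  echoed c hc := h'.echoed c (h.echoed c hc)
  readied c hc := h'.readied c (h.readied c hc)
  active ha := h'.active (h.active ha)
  cfg ha := (h'.cfg (h.active ha)).trans (h.cfg ha)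
  accepted ha sn x hx := h'.accepted (h.active ha) sn x (h.accepted ha sn x hx)
  proposed ha sn x hx := h'.proposed (h.active ha) sn x (h.proposed ha sn x hx)
  epochTimer ha := (h'.epochTimer (h.active ha)).trans (h.epochTimer ha)
  changeTimer τ hτ := (h.changeTimer τ hτ).elim (fun h => Or.inl (h'.active h))
    (h'.changeTimer τ)

theorem Evolves.refl (s : RState P Op) : Evolves s s :=
  ⟨subset_rfl, subset_rfl, subset_rfl, subset_rfl, subset_rfl, List.prefix_rfl, le_rfl,
    fun _ => .refl s⟩

theorem Evolves.trans (h : Evolves s s') (h' : Evolves s' s'') : Evolves s s'' where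
  inbox := h.inbox.trans h'.inbox
  certs := h.certs.trans h'.certs
  stable := h.stable.trans h'.stable
  prepared := h.prepared.trans h'.prepared
  supplied := h.supplied.trans h'.supplied
  queue := h.queue.trans h'.queue
  epoch := h.epoch.trans h'.epoch
  same he := by
    have h1 := h.epoch
    have h2 := h'.epoch
    exact (h.same (by omega)).trans (h'.same (by omega))

theorem evolves_receive (s : RState P Op) (t : ℝ) (src : Option P.Rep) (m : Msg P Op) :
    Evolves s (s.receive t src m) where
  inbox := by simp
  certs := certs_subset_receive ..
  stable := stable_subset_receive ..
  prepared := by simp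
  supplied := supplied_subset_receive ..
  queue := queue_prefix_receive ..
  epoch := by simp
  same _ := by constructor <;> simp +contextual

theorem evolves_callFor {u : P.Rep} {e : ℕ} (he : s.epoch < e) : Evolves s (s.callFor u e) where
  inbox := subset_rfl
  certs := subset_rfl
  stable := subset_rfl
  prepared := subset_rfl
  supplied := subset_rfl
  queue := List.prefix_rfl
  epoch := he.le
  same h := absurd h he.ne'

/-- A local action either calls an epoch-change or stays in the epoch. -/
theorem Act.cases_call {u : P.Rep} {t : ℝ} (h : Act u t s s') :
    (∃ e, s.epoch < e ∧ s' = s.callFor u e) ∨ s'.epoch = s.epoch := by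
  cases h with
  | callFinished | callExpired | callNoProgress | callNext => exact Or.inl ⟨_, Nat.lt_succ_self _, rfl⟩
  | callFollow e _ he => exact Or.inl ⟨e, he.1.1, rfl⟩
  | _ => exact Or.inr rfl

theorem Act.evolves {u : P.Rep} {t : ℝ} (h : Act u t s s') : Evolves s s' := by
  have aux : ∀ {β : Type _} (g : ℕ → Option β) (sn : ℕ) (y : β), g sn = none →
      ∀ sn' x, g sn' = some x → Function.update g sn (some y) sn' = some x := by
    intro β g sn y hg sn' x hx
    rw [Function.update_of_ne, hx]
    rintro rfl
    rw [hg] at hx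
    cases hx
  cases h with
  | callFinished | callExpired | callNoProgress | callNext =>
    exact evolves_callFor (Nat.lt_succ_self _)
  | callFollow e _ he => exact evolves_callFor he.1.1
  | propose sn r l₁ l₂ q₁ q₂ ha hown hl₁ hsn =>
    refine ⟨subset_rfl, subset_rfl, subset_rfl, subset_rfl, subset_rfl, List.prefix_rfl, le_rfl,
      fun _ => { SameEpoch.refl s with proposed := fun _ => ?_ }⟩
    exact aux _ _ _ (by_contra fun h => hsn (Or.inr h))
  | acceptPrePrepare v d r l₁ l₂ ha hg he hacc =>
    exact ⟨subset_rfl, subset_rfl, subset_rfl, subset_rfl, subset_rfl, List.prefix_rfl, le_rfl,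
      fun _ => { SameEpoch.refl s with accepted := fun _ => aux _ _ _ hacc }⟩
  | acceptPrepared v d =>
    exact ⟨subset_rfl, subset_rfl, subset_rfl, Finset.subset_insert _ _, subset_rfl,
      List.prefix_rfl, le_rfl, fun _ => { SameEpoch.refl s with }⟩
  | startTimer _ hn =>
    exact ⟨subset_rfl, subset_rfl, subset_rfl, subset_rfl, subset_rfl,
      List.prefix_rfl, le_rfl, fun _ => { SameEpoch.refl s with
        changeTimer := fun τ hτ => by rw [hn] at hτ; cases hτ }⟩
  | select V ha hp hsel =>
    exact ⟨subset_rfl, subset_rfl, subset_rfl, subset_rfl, subset_rfl,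
      List.prefix_rfl, le_rfl, fun _ => { SameEpoch.refl s with
        selected := fun V' hV' => by rw [hsel] at hV'; cases hV' }⟩
  | echo cfg hn =>
    exact ⟨subset_rfl, subset_rfl, subset_rfl, subset_rfl, subset_rfl,
      List.prefix_rfl, le_rfl, fun _ => { SameEpoch.refl s with
        echoed := fun V' hV' => by rw [hn] at hV'; cases hV' }⟩
  | ready cfg hn =>
    exact ⟨subset_rfl, subset_rfl, subset_rfl, subset_rfl, subset_rfl,
      List.prefix_rfl, le_rfl, fun _ => { SameEpoch.refl s with
        readied := fun V' hV' => by rw [hn] at hV'; cases hV' }⟩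
  | enter V ha =>
    exact ⟨subset_rfl, Finset.subset_union_left, Finset.subset_union_left, subset_rfl, subset_rfl,
      List.prefix_rfl, le_rfl, fun _ => { SameEpoch.refl s with
        active := fun h => absurd h ha
        cfg := fun h => absurd h ha
        accepted := fun h => absurd h ha
        proposed := fun h => absurd h ha
        epochTimer := fun h => absurd h ha
        changeTimer := fun _ _ => Or.inl trivial }⟩

/-! ### Local invariants -/

/-- How the current configuration was obtained. -/
def Entered (s : RState P Op) : Prop :=
  (s.epoch = 1 ∧ s.cfg = firstConfig P Op) ∨
    2 ≤ s.epoch ∧ ∃ V, s.Got (P.primary s.epoch) (.newEpoch s.epoch V) ∧ ValidV P s.epoch V ∧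
      s.Delivered s.cfg ∧ s.cfg = newConfig P s.epoch V

/-- The quorum on which `ready` is sent. -/
def ReadyQuorum (s : RState P Op) (cfg : Config P Op) : Prop :=
  AtLeast P (2 * P.f + 1) (fun w => s.Got w (.echo s.epoch cfg)) ∨
    AtLeast P (P.f + 1) (fun w => s.Got w (.ready s.epoch cfg))

theorem Got.mono {w : P.Rep} {m : Msg P Op} (h : s.Got w m) (hs : s.inbox ⊆ s'.inbox) :
    s'.Got w m := hs h

theorem Delivered.mono {cfg : Config P Op} (h : s.Delivered cfg) (hs : s.inbox ⊆ s'.inbox)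
    (he : s'.epoch = s.epoch) : s'.Delivered cfg := by
  unfold Delivered at h ⊢
  rw [he]
  exact AtLeast.mono le_rfl h fun w hw => hs hw

theorem ReadyQuorum.mono {cfg : Config P Op} (h : s.ReadyQuorum cfg) (hs : s.inbox ⊆ s'.inbox)
    (he : s'.epoch = s.epoch) : s'.ReadyQuorum cfg := by
  unfold ReadyQuorum at h ⊢
  rw [he]
  exact h.imp (AtLeast.mono le_rfl · fun w hw => hs hw) (AtLeast.mono le_rfl · fun w hw => hs hw)

theorem Entered.mono (h : s.Entered) (hs : s.inbox ⊆ s'.inbox) (he : s'.epoch = s.epoch)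
    (hc : s'.cfg = s.cfg) : s'.Entered := by
  rcases h with h | ⟨h2, V, hV, hv, hd, heq⟩
  · left; rwa [he, hc]
  · right
    refine ⟨he ▸ h2, V, ?_, he ▸ hv, ?_, ?_⟩
    · rw [he]; exact hs hV
    · rw [hc]; exact hd.mono hs he
    · rw [hc, he]; exact heq

/-- Invariants of a replica `u` that follows the protocol. -/
structure Inv (u : P.Rep) (s : RState P Op) : Prop where
  epoch_pos : 1 ≤ s.epoch
  inactive_epoch : ¬ s.active → 2 ≤ s.epoch
  inactive_accepted : ¬ s.active → ∀ sn, s.accepted sn = none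
  inactive_proposed : ¬ s.active → ∀ sn, s.proposed sn = none
  call_ne : 2 ≤ s.epoch → s.call ≠ none
  call : ∀ c, s.call = some c → c.sender = u ∧ c.epoch = s.epoch ∧ c.committed ⊆ s.certs ∧
    c.stable ⊆ s.stable
  selected : ∀ V, s.selected = some V → ValidV P s.epoch V ∧
    ∀ c ∈ V, s.Got c.sender (.epochChange c)
  echoed : ∀ cfg, s.echoed = some cfg → s.Got (P.primary s.epoch) (.init s.epoch cfg)
  readied : ∀ cfg, s.readied = some cfg → s.ReadyQuorum cfg
  entered : s.active → s.Entered
  hang : s.active → ∀ sn x, s.cfg.hang sn = some x → s.accepted sn = some x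
  accepted : s.active → ∀ sn x, s.accepted sn = some x → s.cfg.hang sn = some x ∨
    ∃ v, sn ∈ s.cfg.own v ∧ s.Got v (.prePrepare ⟨s.epoch, sn, x⟩)
  proposed : s.active → ∀ sn, s.proposed sn ≠ none →
    ∃ l₁ l₂, s.cfg.own u = l₁ ++ sn :: l₂ ∧ (∀ x ∈ l₁, s.Used x) ∧ s.cfg.hang sn = none
  supplied : ∀ x ∈ s.supplied, x.2 ⊆ s.certs
  commitCert : ∀ src d, (src, Msg.commitCert d) ∈ s.inbox → d ∈ s.certs
  supply : ∀ src ds, (src, Msg.supply ds) ∈ s.inbox → ds ⊆ s.certs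
  checkpointCert : ∀ src c, (src, Msg.checkpointCert c) ∈ s.inbox → c ∈ s.stable
  request : ∀ src r, (src, Msg.request r) ∈ s.inbox → r ∈ s.queue

theorem inv_start (u : P.Rep) : Inv u (RState.start P Op) := by
  constructor
  case accepted => exact fun _ sn x hx => Or.inl hx
  all_goals simp [start, Entered]

theorem Inv.receive {u : P.Rep} (h : Inv u s) (t : ℝ) (src : Option P.Rep) (m : Msg P Op) :
    Inv u (s.receive t src m) := by
  have hev := evolves_receive s t src m
  have hep := receive_epoch s t src m
  constructor
  · simpa using h.epoch_pos
  · simpa using h.inactive_epoch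
  · simpa using h.inactive_accepted
  · simpa using h.inactive_proposed
  · simpa using h.call_ne
  · intro c hc
    rw [receive_call] at hc
    obtain ⟨h1, h2, h3, h4⟩ := h.call c hc
    exact ⟨h1, by rw [hep, h2], h3.trans hev.certs, h4.trans hev.stable⟩
  · intro V hV
    rw [receive_selected] at hV
    obtain ⟨h1, h2⟩ := h.selected V hV
    exact ⟨by rwa [hep], fun c hc => (h2 c hc).mono hev.inbox⟩
  · intro cfg hc
    rw [receive_echoed] at hc
    rw [hep]
    exact (h.echoed cfg hc).mono hev.inbox
  · intro cfg hc
    rw [receive_readied] at hc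
    exact (h.readied cfg hc).mono hev.inbox hep
  · intro ha
    rw [receive_active] at ha
    exact (h.entered ha).mono hev.inbox hep (receive_cfg ..)
  · simpa using h.hang
  · intro ha sn x hx
    rw [receive_active] at ha
    rw [receive_accepted] at hx
    rw [hep, receive_cfg]
    exact (h.accepted ha sn x hx).imp id fun ⟨v, hv, hg⟩ => ⟨v, hv, hg.mono hev.inbox⟩
  · simpa [Used] using h.proposed
  · intro x hx
    rcases mem_receive_supplied _ _ _ _ hx with hx | hx
    · exact (h.supplied x hx).trans hev.certs
    · rw [hx]; exact hev.certs
  · intro src' d hd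
    rw [receive_inbox, Finset.mem_insert] at hd
    rcases hd with hd | hd
    · obtain ⟨rfl, rfl⟩ := Prod.mk.inj hd; exact Finset.mem_insert_self _ _
    · exact hev.certs (h.commitCert _ _ hd)
  · intro src' d hd
    rw [receive_inbox, Finset.mem_insert] at hd
    rcases hd with hd | hd
    · obtain ⟨rfl, rfl⟩ := Prod.mk.inj hd; exact Finset.subset_union_right
    · exact (h.supply _ _ hd).trans hev.certs
  · intro src' d hd
    rw [receive_inbox, Finset.mem_insert] at hd
    rcases hd with hd | hd
    · obtain ⟨rfl, rfl⟩ := Prod.mk.inj hd; exact Finset.mem_insert_self _ _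
    · exact hev.stable (h.checkpointCert _ _ hd)
  · intro src' r hd
    rw [receive_inbox, Finset.mem_insert] at hd
    rcases hd with hd | hd
    · obtain ⟨rfl, rfl⟩ := Prod.mk.inj hd
      simp only [RState.receive]
      split_ifs with hr
      · exact hr
      · simp
    · exact hev.queue.subset (h.request _ _ hd)

theorem Inv.callFor {u : P.Rep} (h : Inv u s) {e : ℕ} (he : s.epoch < e) :
    Inv u (s.callFor u e) where
  epoch_pos := h.epoch_pos.trans he.le
  inactive_epoch _ := by have := h.epoch_pos; show 2 ≤ e; omega
  inactive_accepted _ _ := rfl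
  inactive_proposed _ _ := rfl
  call_ne _ := by simp [RState.callFor]
  call c hc := by
    simp only [RState.callFor, Option.some.injEq] at hc
    subst hc
    exact ⟨rfl, rfl, Finset.filter_subset _ _, subset_rfl⟩
  selected V hV := by simp [RState.callFor] at hV
  echoed V hV := by simp [RState.callFor] at hV
  readied V hV := by simp [RState.callFor] at hV
  entered := False.elim
  hang := False.elim
  accepted := False.elim
  proposed := False.elim
  supplied := h.supplied
  commitCert := h.commitCert
  supply := h.supply
  checkpointCert := h.checkpointCert
  request := h.request

theorem Inv.act {u : P.Rep} {t : ℝ} (h : Inv u s) (ha : Act u t s s') : Inv u s' := by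
  cases ha with
  | callFinished | callExpired | callNoProgress | callNext => exact h.callFor (Nat.lt_succ_self _)
  | callFollow e _ he => exact h.callFor he.1.1
  | propose sn r l₁ l₂ q₁ q₂ ha hown hl₁ hsn =>
    have hmono : ∀ x, s.Used x →
        RState.Used { s with proposed := Function.update s.proposed sn (some r) } x := by
      rintro x (hx | hx)
      · exact Or.inl hx
      · refine Or.inr ?_
        simp only [Function.update_apply]
        split_ifs
        · simp
        · exact hx
    refine { h with inactive_proposed := fun hn => absurd ha hn, proposed := fun _ sn' hsn' => ?_ }
    by_cases heq : sn' = sn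
    · subst heq
      exact ⟨l₁, l₂, hown, fun x hx => hmono x (hl₁ x hx), by_contra fun hne => hsn (Or.inl hne)⟩
    · simp only [Function.update_of_ne heq] at hsn'
      obtain ⟨l₁', l₂', h1, h2, h3⟩ := h.proposed ha sn' hsn'
      exact ⟨l₁', l₂', h1, fun x hx => hmono x (h2 x hx), h3⟩
  | acceptPrePrepare v d r l₁ l₂ ha hg he hacc hown =>
    refine { h with
      inactive_accepted := fun hn => absurd ha hn
      hang := fun _ sn x hx => ?_
      accepted := fun _ sn x hx => ?_ }
    · have hx' := h.hang ha sn x hx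
      simp only
      rw [Function.update_of_ne, hx']
      rintro rfl
      rw [hacc] at hx'
      cases hx'
    · simp only [Function.update_apply] at hx
      split_ifs at hx with heq
      · cases hx
        subst heq
        exact Or.inr ⟨v, by rw [hown]; simp, by rw [← he]; exact hg⟩
      · exact h.accepted ha sn x hx
  | acceptPrepared v d => exact { h with }
  | startTimer => exact { h with }
  | select V ha hp hsel hV hgot =>
    refine { h with selected := fun V' hV' => ?_ }
    simp only [Option.some.injEq] at hV'
    subst hV'
    exact ⟨hV, hgot⟩
  | echo cfg hn hg =>
    refine { h with echoed := fun c hc => ?_ }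
    simp only [Option.some.injEq] at hc
    subst hc
    exact hg
  | ready cfg hn hg =>
    refine { h with readied := fun c hc => ?_ }
    simp only [Option.some.injEq] at hc
    subst hc
    exact hg
  | enter V ha hg hV hd =>
    exact { h with
      inactive_epoch := fun hn => absurd trivial hn
      inactive_accepted := fun hn => absurd trivial hn
      inactive_proposed := fun hn => absurd trivial hn
      call := fun c hc => by
        obtain ⟨h1, h2, h3, h4⟩ := h.call c hc
        exact ⟨h1, h2, h3.trans Finset.subset_union_left, h4.trans Finset.subset_union_left⟩
      entered := fun _ => Or.inr ⟨h.inactive_epoch ha, V, hg, hV, hd, rfl⟩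
      hang := fun _ sn x hx => hx
      accepted := fun _ sn x hx => Or.inl hx
      proposed := fun _ sn hsn => absurd rfl hsn
      supplied := fun x hx => (h.supplied x hx).trans Finset.subset_union_left
      commitCert := fun src d hd => Finset.mem_union_left _ (h.commitCert src d hd)
      supply := fun src d hd => (h.supply src d hd).trans Finset.subset_union_left
      checkpointCert := fun src c hc => Finset.mem_union_left _ (h.checkpointCert src c hc) }

end RState

/-! ### What a sent message says about its sender -/

namespace RState

variable {s s' : RState P Op} {u w : P.Rep}

theorem Sends.prePrepare_inv {d : Entry Client Op} (h : s.Sends u w (.prePrepare d)) :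
    s.active ∧ d.epoch = s.epoch ∧ ∃ r, d.val = some r ∧ s.proposed d.sn = some r := by
  cases h; exact ⟨‹_›, rfl, _, rfl, ‹_›⟩

theorem Sends.preparedCert_inv {d : Entry Client Op} (h : s.Sends u w (.preparedCert d)) :
    s.active ∧ d.epoch = s.epoch ∧ s.accepted d.sn = some d.val := by
  cases h; exact ⟨‹_›, ‹_›, ‹_›⟩

theorem Sends.commit_inv {d : Entry Client Op} (h : s.Sends u w (.commit d)) :
    s.active ∧ d.epoch = s.epoch ∧ d ∈ s.prepared := by
  cases h; exact ⟨‹_›, ‹_›, ‹_›⟩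

theorem Sends.commitCert_inv {d : Entry Client Op} (h : s.Sends u w (.commitCert d)) :
    AtLeast P (2 * P.f + 1) (fun x => s.Got x (.commit d)) := by
  cases h; assumption

theorem Sends.checkpoint_inv {c : Ckpt P Op} (h : s.Sends u w (.checkpoint c)) :
    s.active ∧ c.epoch = s.epoch ∧
      List.Forall₂ (fun sn y => y.1 = sn ∧ (⟨s.epoch, sn, y.2⟩ : Entry Client Op) ∈ s.certs)
        ((s.cfg.own c.leader).take c.log.length) c.log := by
  cases h; exact ⟨‹_›, ‹_›, ‹_›⟩

theorem Sends.checkpointCert_inv {c : Ckpt P Op} (h : s.Sends u w (.checkpointCert c)) :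
    AtLeast P (2 * P.f + 1) (fun x => s.Got x (.checkpoint c)) := by
  cases h; assumption

theorem Sends.epochChange_inv {c : EpochChange P Op} (h : s.Sends u w (.epochChange c)) :
    s.call = some c := by
  cases h; assumption

theorem Sends.init_inv {e : ℕ} {cfg : Config P Op} (h : s.Sends u w (.init e cfg)) :
    e = s.epoch ∧ ∃ V, s.selected = some V ∧ cfg = newConfig P s.epoch V := by
  cases h; exact ⟨rfl, _, ‹_›, rfl⟩

theorem Sends.echo_inv {e : ℕ} {cfg : Config P Op} (h : s.Sends u w (.echo e cfg)) :
    e = s.epoch ∧ s.echoed = some cfg := by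
  cases h; exact ⟨rfl, ‹_›⟩

theorem Sends.ready_inv {e : ℕ} {cfg : Config P Op} (h : s.Sends u w (.ready e cfg)) :
    e = s.epoch ∧ s.readied = some cfg := by
  cases h; exact ⟨rfl, ‹_›⟩

theorem Sends.newEpoch_inv {e : ℕ} {V : Finset (EpochChange P Op)}
    (h : s.Sends u w (.newEpoch e V)) : e = s.epoch ∧ s.selected = some V := by
  cases h; exact ⟨rfl, ‹_›⟩

theorem Sends.fetch_inv {e : ℕ} (h : s.Sends u w (.fetch e)) : e = s.epoch := by
  cases h; rfl

theorem Sends.supply_inv {ds : Finset (Entry Client Op)} (h : s.Sends u w (.supply ds)) :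
    (w, ds) ∈ s.supplied := by
  cases h; assumption

theorem Act.inbox_eq {t : ℝ} (h : Act u t s s') : s'.inbox = s.inbox := by
  cases h <;> rfl

theorem Act.mem_certs {t : ℝ} (h : Act u t s s') {d : Entry Client Op} (hd : d ∈ s'.certs) :
    d ∈ s.certs ∨ ∃ V, s.Got (P.primary s.epoch) (.newEpoch s.epoch V) ∧
      ∃ c ∈ V, d ∈ c.committed := by
  cases h with
  | enter V _ hg =>
    simp only [RState.enter, Finset.mem_union, Finset.mem_biUnion] at hd
    exact hd.imp_right fun hd => ⟨V, hg, hd⟩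
  | _ => exact Or.inl hd

theorem Act.mem_stable {t : ℝ} (h : Act u t s s') {d : Ckpt P Op} (hd : d ∈ s'.stable) :
    d ∈ s.stable ∨ ∃ V, s.Got (P.primary s.epoch) (.newEpoch s.epoch V) ∧
      ∃ c ∈ V, d ∈ c.stable := by
  cases h with
  | enter V _ hg =>
    simp only [RState.enter, Finset.mem_union, Finset.mem_biUnion] at hd
    exact hd.imp_right fun hd => ⟨V, hg, hd⟩
  | _ => exact Or.inl hd

theorem Act.mem_prepared {t : ℝ} (h : Act u t s s') {d : Entry Client Op} (hd : d ∈ s'.prepared) :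
    d ∈ s.prepared ∨
      s.active ∧ d.epoch = s.epoch ∧ ∃ v, s.Got v (.preparedCert d) ∧ d.sn ∈ s.cfg.own v := by
  cases h with
  | acceptPrepared v d' ha hg he hsn =>
    rcases Finset.mem_insert.1 hd with rfl | hd
    · exact Or.inr ⟨ha, he, v, hg, hsn⟩
    · exact Or.inl hd
  | _ => exact Or.inl hd

/-- `s` is about to propose `r` with sequence number `sn`. -/
structure Proposes (s : RState P Op) (u : P.Rep) (sn : ℕ) (r : Request Client Op) : Prop where
  active : s.active
  fresh : ¬ s.Used sn
  first : ∃ q₁ q₂, s.queue = q₁ ++ r :: q₂ ∧ ∀ x ∈ q₁, ¬ s.Eligible u x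
  eligible : s.Eligible u r

theorem Act.proposed {t : ℝ} (h : Act u t s s') {sn : ℕ} {r : Request Client Op}
    (hr : s'.proposed sn = some r) : s.proposed sn = some r ∨ s.Proposes u sn r := by
  cases h with
  | propose sn' r' l₁ l₂ q₁ q₂ ha hown hl₁ hsn hlow hq hq₁ hel =>
    simp only [Function.update_apply] at hr
    split_ifs at hr with heq
    · cases hr
      subst heq
      exact Or.inr ⟨ha, hsn, ⟨q₁, q₂, hq, hq₁⟩, hel⟩
    · exact Or.inl hr
  | callFinished | callExpired | callNoProgress | callNext | callFollow | enter => cases hr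
  | _ => exact Or.inl hr

end RState

/-! ### Quorums -/

section Quorum

variable {byz : Finset P.Rep}

theorem exists_correct (hbyz : byz.card ≤ P.f) {W : Finset P.Rep} (hW : P.f + 1 ≤ W.card) :
    ∃ w ∈ W, w ∉ byz := by
  by_contra! h
  have := Finset.card_le_card (show W ⊆ byz from h)
  omega

theorem AtLeast.exists_correct (hbyz : byz.card ≤ P.f) {q : ℕ} {S : P.Rep → Prop}
    (h : AtLeast P q S) (hq : P.f + 1 ≤ q) : ∃ w, w ∉ byz ∧ S w := by
  obtain ⟨W, hW, hS⟩ := h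
  obtain ⟨w, hw, hb⟩ := FnF.exists_correct hbyz (hq.trans hW)
  exact ⟨w, hb, hS w hw⟩

theorem card_correct (hbyz : byz.card ≤ P.f) : 2 * P.f + 1 ≤ (byzᶜ).card := by
  rw [Finset.card_compl, Fintype.card_fin]
  omega

theorem atLeast_of_correct (hbyz : byz.card ≤ P.f) {q : ℕ} (hq : q ≤ 2 * P.f + 1)
    {S : P.Rep → Prop} (h : ∀ w, w ∉ byz → S w) : AtLeast P q S :=
  ⟨byzᶜ, hq.trans (card_correct hbyz), fun w hw => h w (Finset.mem_compl.1 hw)⟩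

/-- Of `2f+1` replicas, `f+1` are correct. -/
theorem AtLeast.correct (hbyz : byz.card ≤ P.f) {S : P.Rep → Prop}
    (h : AtLeast P (2 * P.f + 1) S) : AtLeast P (P.f + 1) (fun w => w ∉ byz ∧ S w) := by
  obtain ⟨W, hW, hS⟩ := h
  refine ⟨W \ byz, ?_, fun w hw => ?_⟩
  · have := Finset.le_card_sdiff byz W
    omega
  · rw [Finset.mem_sdiff] at hw
    exact ⟨hw.2, hS w hw.1⟩

theorem AtLeast.inter (hbyz : byz.card ≤ P.f) {S S' : P.Rep → Prop}
    (h : AtLeast P (2 * P.f + 1) S) (h' : AtLeast P (2 * P.f + 1) S') :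
    ∃ w, w ∉ byz ∧ S w ∧ S' w := by
  obtain ⟨W, hW, hS⟩ := h
  obtain ⟨W', hW', hS'⟩ := h'
  have h1 := Finset.card_union_add_card_inter W W'
  have h2 : (W ∪ W').card ≤ 3 * P.f + 1 := by
    simpa using Finset.card_le_univ (W ∪ W')
  obtain ⟨w, hw, hb⟩ := FnF.exists_correct hbyz (W := W ∩ W') (by omega)
  rw [Finset.mem_inter] at hw
  exact ⟨w, hb, hS w hw.1, hS' w hw.2⟩

end Quorum

/-! ### Executions -/

namespace Execution

variable {byz : Finset P.Rep} {good : Set Client} (E : Execution P Op byz good)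

theorem step (i : ℕ) (u : P.Rep) : E.state (i + 1) u = E.state i u ∨
    (∃ src m, E.event i = .deliver src u m ∧
      E.state (i + 1) u = (E.state i u).receive (E.time (i + 1)) src m) ∨
    RState.Act u (E.time (i + 1)) (E.state i u) (E.state (i + 1) u) := by
  cases h : E.event i with
  | submit r => exact Or.inl (congrFun (E.on_other i (Or.inr ⟨r, h⟩)) u)
  | idle => exact Or.inl (congrFun (E.on_other i (Or.inl h)) u)
  | deliver src dst m =>
    obtain ⟨h1, h2⟩ := E.on_deliver i src dst m h
    by_cases hu : u = dst
    · subst hu; exact Or.inr (Or.inl ⟨src, m, rfl, h1⟩)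
    · exact Or.inl (h2 u hu)
  | act w =>
    obtain ⟨h1, h2⟩ := E.on_act i w h
    by_cases hu : u = w
    · subst hu; exact Or.inr (Or.inr h1)
    · exact Or.inl (h2 u hu)

theorem inv (i : ℕ) (u : P.Rep) : (E.state i u).Inv u := by
  induction i with
  | zero => rw [E.start]; exact RState.inv_start u
  | succ i ih =>
    rcases E.step i u with h | ⟨src, m, -, h⟩ | h
    · rwa [h]
    · rw [h]; exact ih.receive _ _ _
    · exact ih.act h

theorem evolves {i j : ℕ} (hij : i ≤ j) (u : P.Rep) :
    (E.state i u).Evolves (E.state j u) := by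
  induction j, hij using Nat.le_induction with
  | base => exact .refl _
  | succ j _ ih =>
    refine ih.trans ?_
    rcases E.step j u with h | ⟨src, m, -, h⟩ | h
    · rw [h]; exact .refl _
    · rw [h]; exact RState.evolves_receive _ _ _ _
    · exact h.evolves

theorem epoch_mono {i j : ℕ} (hij : i ≤ j) (u : P.Rep) :
    (E.state i u).epoch ≤ (E.state j u).epoch := (E.evolves hij u).epoch

/-- The state of a replica within an epoch evolves in one direction only. -/
theorem sameEpoch_total {i j : ℕ} {u : P.Rep} (h : (E.state i u).epoch = (E.state j u).epoch) :
    (E.state i u).SameEpoch (E.state j u) ∨ (E.state j u).SameEpoch (E.state i u) := by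
  rcases le_total i j with hij | hij
  · exact Or.inl ((E.evolves hij u).same h.symm)
  · exact Or.inr ((E.evolves hij u).same h)

theorem deliver_of_mem {i : ℕ} {u : P.Rep} {src : Option P.Rep} {m : Msg P Op}
    (h : (src, m) ∈ (E.state i u).inbox) : ∃ j < i, E.event j = .deliver src u m := by
  induction i with
  | zero => rw [E.start] at h; simp [RState.start] at h
  | succ i ih =>
    have old : (src, m) ∈ (E.state i u).inbox → ∃ j < i + 1, E.event j = .deliver src u m :=
      fun h => let ⟨j, hj, h⟩ := ih h; ⟨j, by omega, h⟩
    rcases E.step i u with h' | ⟨src', m', he, h'⟩ | h'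
    · rw [h'] at h; exact old h
    · rw [h', RState.receive_inbox, Finset.mem_insert] at h
      rcases h with h | h
      · obtain ⟨rfl, rfl⟩ := Prod.mk.inj h
        exact ⟨i, by omega, he⟩
      · exact old h
    · rw [h'.inbox_eq] at h; exact old h

theorem mem_of_deliver {i j : ℕ} (hij : i < j) {u : P.Rep} {src : Option P.Rep} {m : Msg P Op}
    (h : E.event i = .deliver src u m) : (src, m) ∈ (E.state j u).inbox := by
  refine (E.evolves (show i + 1 ≤ j from hij) u).inbox ?_
  rw [(E.on_deliver i src u m h).1]
  simp

theorem sends_of_got {i : ℕ} {u w : P.Rep} {m : Msg P Op} (hw : w ∉ byz)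
    (h : (E.state i u).Got w m) : ∃ j < i, (E.state j w).Sends w u m := by
  obtain ⟨k, hk, he⟩ := E.deliver_of_mem h
  obtain ⟨j, hj, hs⟩ := E.authentic k w u m he hw
  exact ⟨j, by omega, hs⟩

/-! ### Genuine certificates -/

/-- The correct ones among `2f+1` replicas have sent `m`. -/
def Supported (i : ℕ) (m : Msg P Op) : Prop :=
  ∃ U : Finset P.Rep, U.card = 2 * P.f + 1 ∧
    ∀ x ∈ U, x ∉ byz → ∃ j ≤ i, ∃ z, (E.state j x).Sends x z m

variable {E}

theorem Supported.mono {i j : ℕ} (hij : i ≤ j) {m : Msg P Op} (h : E.Supported i m) :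
    E.Supported j m := by
  obtain ⟨U, hU, h⟩ := h
  refine ⟨U, hU, fun x hx hb => ?_⟩
  obtain ⟨k, hk, hs⟩ := h x hx hb
  exact ⟨k, hk.trans hij, hs⟩

theorem supported_of_atLeast {i : ℕ} {u : P.Rep} {m : Msg P Op}
    (h : AtLeast P (2 * P.f + 1) (fun x => (E.state i u).Got x m)) : E.Supported i m := by
  obtain ⟨W, hW, h⟩ := h
  obtain ⟨U, hUW, hU⟩ := Finset.exists_subset_card_eq hW
  refine ⟨U, hU, fun x hx hb => ?_⟩
  obtain ⟨j, hj, hs⟩ := E.sends_of_got hb (h x (hUW hx))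
  exact ⟨j, hj.le, u, hs⟩

variable (E)

/-- The commit-certificates and the stable checkpoints known at `i` are genuine. -/
def GenuineAt (i : ℕ) : Prop := ∀ u, (∀ d ∈ (E.state i u).certs, E.Supported i (.commit d)) ∧
  ∀ c ∈ (E.state i u).stable, E.Supported i (.checkpoint c)

variable {E}

theorem supported_of_epochChange {i : ℕ} (ih : ∀ j ≤ i, E.GenuineAt j) {w u : P.Rep}
    {c : EpochChange P Op} (h : E.event i = .deliver (some w) u (.epochChange c)) :
    (∀ d ∈ c.committed, E.Supported i (.commit d)) ∧
      ∀ s ∈ c.stable, E.Supported i (.checkpoint s) := by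
  by_cases hw : w ∈ byz
  · have := (E.unforgeable i w u _ h hw).2
    exact ⟨fun d hd => this _ (Or.inr (Or.inr (Or.inr ⟨d, hd, rfl⟩))),
      fun s hs => this _ (Or.inr (Or.inl ⟨s, hs, rfl⟩))⟩
  · obtain ⟨j, hj, hs⟩ := E.authentic i w u _ h hw
    obtain ⟨-, -, h1, h2⟩ := (E.inv j w).call c hs.epochChange_inv
    exact ⟨fun d hd => ((ih j hj w).1 d (h1 hd)).mono hj,
      fun s hs => ((ih j hj w).2 s (h2 hs)).mono hj⟩

theorem supported_of_newEpoch {i : ℕ} (ih : ∀ j ≤ i, E.GenuineAt j) {w u : P.Rep} {e : ℕ}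
    {V : Finset (EpochChange P Op)} (h : (E.state i u).Got w (.newEpoch e V))
    {c : EpochChange P Op} (hc : c ∈ V) :
    (∀ d ∈ c.committed, E.Supported i (.commit d)) ∧
      ∀ s ∈ c.stable, E.Supported i (.checkpoint s) := by
  by_cases hw : w ∈ byz
  · obtain ⟨k, hk, he⟩ := E.deliver_of_mem h
    have : ∀ s ∈ _, E.Supported k s := (E.unforgeable k w u _ he hw).2
    exact ⟨fun d hd => (this _ ⟨c, hc, Or.inr (Or.inr (Or.inr ⟨d, hd, rfl⟩))⟩).mono hk.le,
      fun s hs => (this _ ⟨c, hc, Or.inr (Or.inl ⟨s, hs, rfl⟩)⟩).mono hk.le⟩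
  · obtain ⟨j, hj, hs⟩ := E.sends_of_got hw h
    obtain ⟨k, hk, he⟩ := E.deliver_of_mem (((E.inv j w).selected V hs.newEpoch_inv.2).2 c hc)
    have := supported_of_epochChange (fun j' hj' => ih j' (by omega)) he
    exact ⟨fun d hd => (this.1 d hd).mono (by omega), fun s hs => (this.2 s hs).mono (by omega)⟩

theorem supported_of_commitCert {i : ℕ} {w u : P.Rep} {d : Entry Client Op}
    (h : E.event i = .deliver (some w) u (.commitCert d)) : E.Supported i (.commit d) := by
  by_cases hw : w ∈ byz
  · exact (E.unforgeable i w u _ h hw).2 _ rfl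
  · obtain ⟨j, hj, hs⟩ := E.authentic i w u _ h hw
    exact (supported_of_atLeast hs.commitCert_inv).mono hj

theorem supported_of_checkpointCert {i : ℕ} {w u : P.Rep} {c : Ckpt P Op}
    (h : E.event i = .deliver (some w) u (.checkpointCert c)) :
    E.Supported i (.checkpoint c) := by
  by_cases hw : w ∈ byz
  · exact (E.unforgeable i w u _ h hw).2 _ rfl
  · obtain ⟨j, hj, hs⟩ := E.authentic i w u _ h hw
    exact (supported_of_atLeast hs.checkpointCert_inv).mono hj

theorem supported_of_supply {i : ℕ} (ih : ∀ j ≤ i, E.GenuineAt j) {w u : P.Rep}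
    {ds : Finset (Entry Client Op)} (h : E.event i = .deliver (some w) u (.supply ds))
    {d : Entry Client Op} (hd : d ∈ ds) : E.Supported i (.commit d) := by
  by_cases hw : w ∈ byz
  · exact (E.unforgeable i w u _ h hw).2 _ ⟨d, hd, rfl⟩
  · obtain ⟨j, hj, hs⟩ := E.authentic i w u _ h hw
    exact ((ih j hj w).1 d ((E.inv j w).supplied _ hs.supply_inv hd)).mono hj

theorem genuineAt (i : ℕ) : E.GenuineAt i := by
  induction i using Nat.strong_induction_on with
  | _ i ih =>
    cases i with
    | zero => intro u; rw [E.start]; simp [RState.start]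
    | succ i =>
      replace ih : ∀ j ≤ i, E.GenuineAt j := fun j hj => ih j (by omega)
      have ihi := ih i le_rfl
      intro u
      rcases E.step i u with h | ⟨src, m, he, h⟩ | h
      · rw [h]
        exact ⟨fun d hd => ((ihi u).1 d hd).mono (by omega),
          fun c hc => ((ihi u).2 c hc).mono (by omega)⟩
      · rw [h]
        have hsrc : (∃ r, m = .request r) ∨ ∃ w, src = some w := by
          cases src with
          | none => exact Or.inl (E.from_client i u m he)
          | some w => exact Or.inr ⟨w, rfl⟩
        constructor
        · intro d hd
          refine Supported.mono (Nat.le_succ i) ?_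
          rcases RState.mem_receive_certs _ _ _ _ hd with hd | rfl | ⟨ds, rfl, hds⟩
          · exact (ihi u).1 d hd
          · rcases hsrc with ⟨r, h⟩ | ⟨w, rfl⟩
            · cases h
            · exact supported_of_commitCert he
          · rcases hsrc with ⟨r, h⟩ | ⟨w, rfl⟩
            · cases h
            · exact supported_of_supply ih he hds
        · intro c hc
          refine Supported.mono (Nat.le_succ i) ?_
          rcases RState.mem_receive_stable _ _ _ _ hc with hc | rfl
          · exact (ihi u).2 c hc
          · rcases hsrc with ⟨r, h⟩ | ⟨w, rfl⟩
            · cases h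
            · exact supported_of_checkpointCert he
      · constructor
        · intro d hd
          refine Supported.mono (Nat.le_succ i) ?_
          rcases h.mem_certs hd with hd | ⟨V, hg, c, hc, hd⟩
          · exact (ihi u).1 d hd
          · exact (supported_of_newEpoch ih hg hc).1 d hd
        · intro s hs
          refine Supported.mono (Nat.le_succ i) ?_
          rcases h.mem_stable hs with hs | ⟨V, hg, c, hc, hs⟩
          · exact (ihi u).2 s hs
          · exact (supported_of_newEpoch ih hg hc).2 s hs

/-! ### Agreement on the configurations -/

variable (E) in
/-- `cfg` is the configuration with which some correct replica enters epoch `e`. -/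
def IsConfig (e : ℕ) (cfg : Config P Op) : Prop :=
  ∃ i, ∃ u ∉ byz, (E.state i u).active ∧ (E.state i u).epoch = e ∧ (E.state i u).cfg = cfg

theorem IsConfig.sound {e : ℕ} {cfg : Config P Op} (h : E.IsConfig e cfg) : cfg.Sound e := by
  obtain ⟨i, u, -, ha, rfl, rfl⟩ := h
  rcases (E.inv i u).entered ha with ⟨he, hc⟩ | ⟨-, V, -, -, -, hc⟩
  · rw [he, hc]; exact buildConfig_sound _ _ _
  · rw [hc]; exact newConfig_sound _ _

theorem IsConfig.unique (hbyz : byz.card ≤ P.f) {e : ℕ} {cfg cfg' : Config P Op}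
    (h : E.IsConfig e cfg) (h' : E.IsConfig e cfg') : cfg = cfg' := by
  obtain ⟨i, u, hu, ha, he, rfl⟩ := h
  obtain ⟨i', u', hu', ha', he', rfl⟩ := h'
  rcases (E.inv i u).entered ha with ⟨h1, hc⟩ | ⟨h2, V, -, -, hd, -⟩ <;>
    rcases (E.inv i' u').entered ha' with ⟨h1', hc'⟩ | ⟨h2', V', -, -, hd', -⟩
  · rw [hc, hc']
  · omega
  · omega
  · unfold RState.Delivered at hd hd'
    rw [he] at hd
    rw [he'] at hd'
    obtain ⟨w, hw, hg, hg'⟩ := AtLeast.inter hbyz hd hd'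
    obtain ⟨j, -, hs⟩ := E.sends_of_got hw hg
    obtain ⟨j', -, hs'⟩ := E.sends_of_got hw hg'
    have h1 := hs.ready_inv
    have h2 := hs'.ready_inv
    rcases E.sameEpoch_total (h1.1.symm.trans h2.1) with h | h
    · have := h.readied _ h1.2
      rw [h2.2] at this
      exact (Option.some.inj this).symm
    · have := h.readied _ h2.2
      rw [h1.2] at this
      exact Option.some.inj this

/-! ### Origin of certificates and proposals -/

theorem prepared_origin {i : ℕ} {u : P.Rep} {d : Entry Client Op}
    (h : d ∈ (E.state i u).prepared) : ∃ j ≤ i, (E.state j u).active ∧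
      d.epoch = (E.state j u).epoch ∧ ∃ v, (E.state j u).Got v (.preparedCert d) ∧
        d.sn ∈ (E.state j u).cfg.own v := by
  induction i with
  | zero => rw [E.start] at h; simp [RState.start] at h
  | succ i ih =>
    have old : d ∈ (E.state i u).prepared → ∃ j ≤ i + 1, (E.state j u).active ∧
        d.epoch = (E.state j u).epoch ∧ ∃ v, (E.state j u).Got v (.preparedCert d) ∧
          d.sn ∈ (E.state j u).cfg.own v :=
      fun h => let ⟨j, hj, h⟩ := ih h; ⟨j, Nat.le_succ_of_le hj, h⟩
    rcases E.step i u with h' | ⟨src', m', he, h'⟩ | h'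
    · rw [h'] at h; exact old h
    · rw [h', RState.receive_prepared] at h; exact old h
    · rcases h'.mem_prepared h with h | h
      · exact old h
      · exact ⟨i, Nat.le_succ i, h⟩

/-- A sequence number of a correct leader is committed only with a value accepted by the leader. -/
theorem accepted_of_supported (hbyz : byz.card ≤ P.f) {i e sn : ℕ} {v : P.Rep}
    {x : Option (Request Client Op)} {cfg : Config P Op} (hv : v ∉ byz) (hcfg : E.IsConfig e cfg)
    (hsn : sn ∈ cfg.own v) (h : E.Supported i (.commit ⟨e, sn, x⟩)) :
    ∃ j ≤ i, (E.state j v).active ∧ (E.state j v).epoch = e ∧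
      (E.state j v).accepted sn = some x := by
  obtain ⟨U, hU, h⟩ := h
  obtain ⟨y, hyU, hy⟩ := exists_correct hbyz (W := U) (by omega)
  obtain ⟨j, hj, z, hs⟩ := h y hyU hy
  obtain ⟨k, hk, ha, he, w, hg, hw⟩ := prepared_origin hs.commit_inv.2.2
  have hc : (E.state k y).cfg = cfg :=
    IsConfig.unique hbyz ⟨k, y, hy, ha, he.symm, rfl⟩ hcfg
  rw [hc] at hw
  obtain rfl := hcfg.sound.own_unique hw hsn
  obtain ⟨l, hl, hs'⟩ := E.sends_of_got hv hg
  obtain ⟨h1, h2, h3⟩ := hs'.preparedCert_inv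
  exact ⟨l, by omega, h1, h2.symm, h3⟩

theorem proposed_origin {i : ℕ} {u : P.Rep} {sn : ℕ} {r : Request Client Op}
    (ha : (E.state i u).active) (h : (E.state i u).proposed sn = some r) :
    ∃ j < i, (E.state j u).epoch = (E.state i u).epoch ∧ (E.state j u).Proposes u sn r := by
  induction i with
  | zero => rw [E.start] at h; simp [RState.start] at h
  | succ i ih =>
    have old : (E.state i u).active → (E.state i u).proposed sn = some r →
        (E.state (i + 1) u).epoch = (E.state i u).epoch →
        ∃ j < i + 1, (E.state j u).epoch = (E.state (i + 1) u).epoch ∧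
          (E.state j u).Proposes u sn r :=
      fun ha h he => let ⟨j, hj, h, hp⟩ := ih ha h; ⟨j, Nat.lt_succ_of_lt hj, h.trans he.symm, hp⟩
    rcases E.step i u with h' | ⟨src', m', he, h'⟩ | h'
    · rw [h'] at h ha; exact old ha h (by rw [h'])
    · rw [h'] at h ha
      exact old (by simpa using ha) (by simpa using h) (by rw [h']; simp)
    · have hep : (E.state (i + 1) u).epoch = (E.state i u).epoch := by
        rcases h'.cases_call with ⟨e, -, heq⟩ | h
        · rw [heq] at ha; exact ha.elim
        · exact h
      rcases h'.proposed h with h | h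
      · refine old (by_contra fun hn => ?_) h hep
        rw [(E.inv i u).inactive_proposed hn] at h
        cases h
      · exact ⟨i, Nat.lt_succ_self i, hep.symm, h⟩

/-! ### Calls for epoch-changes -/

theorem epoch_of_sends_epochChange {i : ℕ} {u w : P.Rep} {c : EpochChange P Op}
    (h : (E.state i u).Sends u w (.epochChange c)) : c.sender = u ∧ c.epoch = (E.state i u).epoch :=
  let h := (E.inv i u).call c h.epochChange_inv
  ⟨h.1, h.2.1⟩

theorem le_epoch_of_calledBy {i e : ℕ} {u w : P.Rep} (hw : w ∉ byz)
    (h : (E.state i u).CalledBy w e) : e ≤ (E.state i w).epoch := by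
  obtain ⟨c, hg, -, rfl⟩ := h
  obtain ⟨j, hj, hs⟩ := E.sends_of_got hw hg
  rw [(epoch_of_sends_epochChange hs).2]
  exact E.epoch_mono hj.le w

variable (E) in
/-- `f + 1` correct replicas have reached epoch `e`. -/
def Reached (e i : ℕ) : Prop :=
  AtLeast P (P.f + 1) (fun w => w ∉ byz ∧ e ≤ (E.state i w).epoch)

theorem reached_of_calledBy (hbyz : byz.card ≤ P.f) {i e : ℕ} {u : P.Rep}
    (h : AtLeast P (2 * P.f + 1) (fun w => ∃ e', e ≤ e' ∧ (E.state i u).CalledBy w e')) :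
    E.Reached e i :=
  AtLeast.mono le_rfl (h.correct hbyz) fun _ ⟨hw, _, he, hc⟩ =>
    ⟨hw, he.trans (le_epoch_of_calledBy hw hc)⟩

theorem reached_of_newEpoch (hbyz : byz.card ≤ P.f) {i e : ℕ} {u w : P.Rep}
    {V : Finset (EpochChange P Op)} (h : (E.state i u).Got w (.newEpoch e V))
    (hV : ValidV P e V) : E.Reached e i := by
  obtain ⟨hcard, hep, hinj⟩ := hV
  have key : ∀ c ∈ V, c.sender ∉ byz → e ≤ (E.state i c.sender).epoch := by
    intro c hc hb
    obtain ⟨j, hj, z, hs⟩ : ∃ j ≤ i, ∃ z, (E.state j c.sender).Sends c.sender z (.epochChange c) := by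
      by_cases hw : w ∈ byz
      · obtain ⟨k, hk, he⟩ := E.deliver_of_mem h
        obtain ⟨j, hj, hs⟩ := (E.unforgeable k w u _ he hw).1 _ ⟨c, hc, rfl⟩ hb
        exact ⟨j, by omega, hs⟩
      · obtain ⟨k, hk, hs⟩ := E.sends_of_got hw h
        obtain ⟨j, hj, hs⟩ := E.sends_of_got hb
          (((E.inv k w).selected V hs.newEpoch_inv.2).2 c hc)
        exact ⟨j, by omega, w, hs⟩
    rw [← hep c hc, (epoch_of_sends_epochChange hs).2]
    exact E.epoch_mono hj _
  have h2 : AtLeast P (2 * P.f + 1) (fun w => w ∉ byz → e ≤ (E.state i w).epoch) := by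
    refine ⟨V.image EpochChange.sender, ?_, fun w hw => ?_⟩
    · rw [Finset.card_image_of_injOn (fun c hc c' hc' => hinj c hc c' hc'), hcard]
    · obtain ⟨c, hc, rfl⟩ := Finset.mem_image.1 hw
      exact key c hc
  exact AtLeast.mono le_rfl (h2.correct hbyz) fun w hw => ⟨hw.1, hw.2 hw.1⟩

end Execution

/-- How a replica leaves an epoch. -/
theorem RState.Act.cases_leave {u : P.Rep} {t : ℝ} {s s' : RState P Op} {e : ℕ}
    (h : RState.Act u t s s') (h1 : s.epoch ≤ e) (h2 : e < s'.epoch) :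
    AtLeast P (P.f + 1) (fun w => ∃ e', e < e' ∧ s.CalledBy w e') ∨
      s.epoch = e ∧ ((s.active ∧ ∀ v, s.Finished v) ∨ (s.active ∧ s.epochTimer ≤ t) ∨
        (s.active ∧ ∃ v, s.progressTimer v ≤ t) ∨ ∃ τ, s.changeTimer = some τ ∧ τ ≤ t) := by
  cases h with
  | callFinished ha hf =>
    have : e < s.epoch + 1 := h2
    exact Or.inr ⟨by omega, Or.inl ⟨ha, hf⟩⟩
  | callExpired ha hf =>
    have : e < s.epoch + 1 := h2
    exact Or.inr ⟨by omega, Or.inr (Or.inl ⟨ha, hf⟩)⟩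
  | callNoProgress ha hf =>
    have : e < s.epoch + 1 := h2
    obtain ⟨W, hW, hf⟩ := hf
    obtain ⟨v, hv⟩ := Finset.card_pos.1 (show 0 < W.card by omega)
    exact Or.inr ⟨by omega, Or.inr (Or.inr (Or.inl ⟨ha, v, hf v hv⟩))⟩
  | callNext τ _ hτ hle =>
    have : e < s.epoch + 1 := h2
    exact Or.inr ⟨by omega, Or.inr (Or.inr (Or.inr ⟨τ, hτ, hle⟩))⟩
  | callFollow e' hW hl =>
    refine Or.inl (AtLeast.mono le_rfl hW ?_)
    rintro w ⟨hw, e'', he'', hc⟩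
    exact ⟨e'', lt_of_lt_of_le h2 (hl.2 ⟨he'', w, hw, hc⟩), hc⟩
  | _ => exact absurd h2 (not_lt.2 h1)

namespace Execution

variable {byz : Finset P.Rep} {good : Set Client} (E : Execution P Op byz good)

/-! ### Real time -/

theorem time_nonneg (i : ℕ) : 0 ≤ E.time i := by
  rw [← E.time_zero]; exact E.time_mono (Nat.zero_le i)

theorem exists_lt_time (t : ℝ) : ∃ i, t < E.time (i + 1) := by
  obtain ⟨i, hi⟩ := (E.time_unbounded.eventually_gt_atTop t).exists
  exact ⟨i, hi.trans_le (E.time_mono (Nat.le_succ i))⟩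

/-- The index of the state at real time `t`. -/
def upTo (t : ℝ) : ℕ := Nat.find (E.exists_lt_time t)

theorem lt_time_upTo (t : ℝ) : t < E.time (E.upTo t + 1) := Nat.find_spec (E.exists_lt_time t)

variable {E}

theorem time_upTo_le {t : ℝ} (ht : 0 ≤ t) : E.time (E.upTo t) ≤ t := by
  rcases h : E.upTo t with _ | i
  · rwa [E.time_zero]
  · exact not_lt.1 (Nat.find_min (E.exists_lt_time t) (show i < E.upTo t by omega))

theorem le_upTo {t : ℝ} {i : ℕ} (h : E.time i ≤ t) : i ≤ E.upTo t := by
  by_contra! hlt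
  exact absurd (E.time_mono (show E.upTo t + 1 ≤ i from hlt)) (not_le.2 (h.trans_lt (E.lt_time_upTo t)))

theorem upTo_mono {t t' : ℝ} (ht : 0 ≤ t) (h : t ≤ t') : E.upTo t ≤ E.upTo t' :=
  le_upTo ((time_upTo_le ht).trans h)

theorem not_act {t : ℝ} (ht : 0 ≤ t) {u : P.Rep} (hu : u ∉ byz) (s : RState P Op) :
    ¬ RState.Act u t (E.state (E.upTo t) u) s :=
  E.urgent _ t (time_upTo_le ht) (E.lt_time_upTo t) u hu s

theorem got_of_sends {t : ℝ} (ht : 0 ≤ t) (hG : E.GST ≤ t) {u w : P.Rep} (hu : u ∉ byz)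
    (hw : w ∉ byz) {m : Msg P Op} (h : (E.state (E.upTo t) u).Sends u w m) :
    (E.state (E.upTo (t + P.Δ)) w).Got u m := by
  obtain ⟨i, he, hi⟩ := E.network _ u w m hu hw h
  refine E.mem_of_deliver (Nat.lt_of_succ_le (le_upTo (hi.trans ?_))) he
  have := max_le (time_upTo_le (E := E) ht) hG
  linarith

theorem exists_got_of_sends {i : ℕ} {u w : P.Rep} (hu : u ∉ byz) (hw : w ∉ byz) {m : Msg P Op}
    (h : (E.state i u).Sends u w m) : ∃ j, (E.state j w).Got u m := by
  obtain ⟨j, he, -⟩ := E.network _ u w m hu hw h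
  exact ⟨j + 1, E.mem_of_deliver (Nat.lt_succ_self j) he⟩

theorem exists_call {i : ℕ} {u : P.Rep} (h : 2 ≤ (E.state i u).epoch) :
    ∃ c, c.sender = u ∧ c.epoch = (E.state i u).epoch ∧
      ∀ w, (E.state i u).Sends u w (.epochChange c) := by
  obtain ⟨c, hc⟩ := Option.ne_none_iff_exists'.1 ((E.inv i u).call_ne h)
  obtain ⟨h1, h2, -⟩ := (E.inv i u).call c hc
  exact ⟨c, h1, h2, fun w => .epochChange w c hc⟩

theorem exists_common {p : P.Rep → ℕ → Prop} (hp : ∀ w i j, i ≤ j → p w i → p w j)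
    (h : ∀ w ∉ byz, ∃ i, p w i) : ∃ i, ∀ w ∉ byz, p w i := by
  choose! i hi using h
  exact ⟨Finset.univ.sup i, fun w hw => hp w _ _ (Finset.le_sup (Finset.mem_univ w)) (hi w hw)⟩

/-! ### Progress of the epochs -/

/-- A correct replica leaves every epoch that all correct replicas reach. -/
theorem exists_epoch_gt (hbyz : byz.card ≤ P.f) {e N : ℕ}
    (hN : ∀ w ∉ byz, e ≤ (E.state N w).epoch) {u : P.Rep} (hu : u ∉ byz) :
    ∃ i, e < (E.state i u).epoch := by
  by_contra! hle
  have hep : ∀ i, N ≤ i → (E.state i u).epoch = e := fun i hi =>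
    le_antisymm (hle i) ((hN u hu).trans (E.epoch_mono hi u))
  have hsame : ∀ i j, N ≤ i → i ≤ j → (E.state i u).SameEpoch (E.state j u) := fun i j hi hij =>
    (E.evolves hij u).same ((hep j (hi.trans hij)).trans (hep i hi).symm)
  have hinact : ∀ i, N ≤ i → ¬ (E.state i u).active := by
    intro i hi ha
    set t := max (E.time i) (E.state i u).epochTimer with ht
    have h0 : 0 ≤ t := (E.time_nonneg i).trans (le_max_left _ _)
    have hs := hsame i (E.upTo t) hi (le_upTo (le_max_left _ _))
    refine not_act h0 hu _ (.callExpired (hs.active ha) ?_)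
    rw [hs.epochTimer ha]
    exact le_max_right _ _
  have he : 2 ≤ e := hep N le_rfl ▸ (E.inv N u).inactive_epoch (hinact N le_rfl)
  obtain ⟨M, hM⟩ : ∃ M, ∀ w ∉ byz, ∃ e', e ≤ e' ∧ (E.state M u).CalledBy w e' := by
    refine exists_common ?_ fun w hw => ?_
    · rintro w i j hij ⟨e', he', c, hg, hc⟩
      exact ⟨e', he', c, hg.mono (E.evolves hij u).inbox, hc⟩
    · obtain ⟨c, h1, h2, hs⟩ := exists_call (he.trans (hN w hw))
      obtain ⟨j, hj⟩ := exists_got_of_sends hw hu (hs u)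
      exact ⟨j, _, hN w hw, c, hj, h1, h2⟩
  set t := E.time (max M N) with ht
  have h0 : 0 ≤ t := E.time_nonneg _
  have hi : max M N ≤ E.upTo t := le_upTo le_rfl
  have hiN : N ≤ E.upTo t := (le_max_right _ _).trans hi
  rcases hc : (E.state (E.upTo t) u).changeTimer with _ | τ
  · refine not_act h0 hu _ (.startTimer (hinact _ hiN) hc ?_)
    rw [hep _ hiN]
    refine atLeast_of_correct hbyz le_rfl fun w hw => ?_
    obtain ⟨e', he', c, hg, hc⟩ := hM w hw
    exact ⟨e', he', c, hg.mono (E.evolves ((le_max_left _ _).trans hi) u).inbox, hc⟩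
  · have hle' := upTo_mono (E := E) h0 (le_max_left t τ)
    refine not_act (h0.trans (le_max_left t τ)) hu _
      (.callNext τ (hinact _ (hiN.trans hle')) ?_ (le_max_right _ _))
    exact ((hsame _ _ hiN hle').changeTimer τ hc).resolve_left (hinact _ (hiN.trans hle'))

/-- All correct replicas reach every epoch. -/
theorem exists_le_epoch (hbyz : byz.card ≤ P.f) (e : ℕ) :
    ∃ i, ∀ w ∉ byz, e ≤ (E.state i w).epoch := by
  induction e with
  | zero => exact ⟨0, fun _ _ => Nat.zero_le _⟩
  | succ e ih =>
    obtain ⟨N, hN⟩ := ih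
    exact exists_common (p := fun w i => e + 1 ≤ (E.state i w).epoch)
      (fun w i j hij h => h.trans (E.epoch_mono hij w)) fun w hw => exists_epoch_gt hbyz hN hw

/-! ### Timers -/

theorem timers (hbyz : byz.card ≤ P.f) {e j₀ : ℕ} (he : 2 ≤ e)
    (hmin : ∀ i, E.Reached e i → j₀ ≤ i) (hTe : 0 ≤ P.Te) (i : ℕ) (u : P.Rep) (hep : (E.state i u).epoch = e) :
    (∀ τ, (E.state i u).changeTimer = some τ → E.time j₀ + P.Te ≤ τ) ∧
      ((E.state i u).active → E.time j₀ + P.T ≤ (E.state i u).epochTimer ∧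
        ∀ v, E.time j₀ + 5 * P.Δ + P.Tp ≤ (E.state i u).progressTimer v) := by
  induction i with
  | zero =>
    rw [E.start] at hep
    have : 1 = e := hep
    omega
  | succ i ih =>
    have hle : j₀ ≤ i → E.time j₀ ≤ E.time (i + 1) := fun h => E.time_mono (by omega)
    rcases E.step i u with h | ⟨src, m, -, h⟩ | h
    · rw [h] at hep ⊢; exact ih hep
    · rw [h] at hep ⊢
      rw [RState.receive_epoch] at hep
      simp only [RState.receive_changeTimer, RState.receive_active, RState.receive_epochTimer]
      obtain ⟨h1, h2⟩ := ih hep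
      exact ⟨h1, fun ha => ⟨(h2 ha).1, fun v =>
        ((h2 ha).2 v).trans (RState.le_receive_progressTimer _ _ _ _ v)⟩⟩
    · have hr := fun v V h hV => hle (hmin i (reached_of_newEpoch hbyz (u := u) (w := v) (V := V) h hV))
      have hc := fun h => hle (hmin i (reached_of_calledBy hbyz (u := u) h))
      generalize E.state i u = s at h ih hr hc
      generalize E.state (i + 1) u = s' at h hep ⊢
      cases h with
      | callFinished | callExpired | callNoProgress | callNext | callFollow =>
        exact ⟨fun τ hτ => (Option.some_ne_none τ hτ.symm).elim, False.elim⟩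
      | startTimer hn _ hcall =>
        refine ⟨fun τ hτ => ?_, fun ha => absurd ha hn⟩
        simp only [Option.some.injEq] at hτ
        subst hτ hep
        refine add_le_add (hc hcall) ?_
        unfold changeTimeout
        split_ifs
        · exact le_mul_of_one_le_right hTe (one_le_pow₀ (by norm_num))
        · exact le_rfl
      | enter V _ hg hV hd =>
        subst hep
        have := hr _ V hg hV
        refine ⟨fun τ hτ => (Option.some_ne_none τ hτ.symm).elim, fun _ => ⟨?_, fun v => ?_⟩⟩
        · simp only [RState.enter]; linarith
        · simp only [RState.enter]; linarith
      | _ => exact ih hep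

/-- The first correct replica that leaves an epoch soon has finished it. -/
theorem exists_finished (hbyz : byz.card ≤ P.f) {e j₀ : ℕ} (he : 2 ≤ e)
    (hmin : ∀ i, E.Reached e i → j₀ ≤ i) {t : ℝ} (hTe : E.time j₀ + t < E.time j₀ + P.Te) (ht : 0 ≤ t)
    (hT : t < P.T) (hTp : t < 5 * P.Δ + P.Tp) {n : ℕ} (hn : E.time n ≤ E.time j₀ + t)
    {u : P.Rep} (hu : u ∉ byz) (hgt : e < (E.state n u).epoch) :
    ∃ i, ∃ w ∉ byz, (E.state i w).active ∧ (E.state i w).epoch = e ∧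
      ∀ v, (E.state i w).Finished v := by
  have hex : ∃ n, ∃ u ∉ byz, e < (E.state n u).epoch := ⟨n, u, hu, hgt⟩
  have hfn : Nat.find hex ≤ n := Nat.find_min' hex ⟨u, hu, hgt⟩
  obtain ⟨w, hw, hgt'⟩ := Nat.find_spec hex
  have hprev := fun m hm => Nat.find_min (H := hex) (m := m) hm
  generalize Nat.find hex = k at hfn hgt' hprev
  rcases k with _ | i
  · rw [E.start] at hgt'
    have : e < 1 := hgt'
    omega
  · have hle : ∀ x ∉ byz, (E.state i x).epoch ≤ e := fun x hx =>
      not_lt.1 fun h => hprev i (Nat.lt_succ_self i) ⟨x, hx, h⟩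
    have htime : E.time (i + 1) ≤ E.time j₀ + t := (E.time_mono hfn).trans hn
    rcases E.step i w with h | ⟨src, m, -, h⟩ | h
    · rw [h] at hgt'; exact absurd hgt' (not_lt.2 (hle w hw))
    · rw [h, RState.receive_epoch] at hgt'; exact absurd hgt' (not_lt.2 (hle w hw))
    · rcases h.cases_leave (hle w hw) hgt' with h | ⟨hep, h⟩
      · obtain ⟨x, hx, e', he', hc⟩ := h.exists_correct hbyz le_rfl
        have := le_epoch_of_calledBy hx hc
        have := hle x hx
        omega
      · have htim := timers hbyz he hmin (by linarith) i w hep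
        rcases h with h | ⟨ha, h⟩ | ⟨ha, v, h⟩ | ⟨τ, h, h'⟩
        · exact ⟨i, w, hw, h.1, hep, h.2⟩
        · have := (htim.2 ha).1; linarith
        · have := (htim.2 ha).2 v; linarith
        · have := htim.1 τ h; linarith


/-! ### An epoch with a correct primary after stabilization -/

variable (E) in
/-- `J n` is the index reached `n` message delays after `f + 1` correct replicas have called for
epoch `e`; its primary is correct, and no correct replica leaves it within `17` message delays. -/
structure StableEpoch (e : ℕ) (J : ℕ → ℕ) : Prop where
  mono : Monotone J
  got : ∀ n {u w m}, u ∉ byz → w ∉ byz → (E.state (J n) u).Sends u w m →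
    (E.state (J (n + 1)) w).Got u m
  quiet : ∀ n {u}, u ∉ byz → ∃ t, ∀ s, ¬ RState.Act u t (E.state (J n) u) s
  two_le : 2 ≤ e
  reached : E.Reached e (J 0)
  stay : ∀ u ∉ byz, (E.state (J 17) u).epoch ≤ e
  primary : P.primary e ∉ byz

theorem selected_unique {i j : ℕ} {u : P.Rep} {V V' : Finset (EpochChange P Op)}
    (h : (E.state i u).epoch = (E.state j u).epoch) (hV : (E.state i u).selected = some V)
    (hV' : (E.state j u).selected = some V') : V = V' := by
  rcases E.sameEpoch_total h with h | h
  · have := h.selected V hV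
    rw [hV'] at this
    exact (Option.some.inj this).symm
  · have := h.selected V' hV'
    rw [hV] at this
    exact Option.some.inj this

theorem echoed_eq {e i k : ℕ} {V : Finset (EpochChange P Op)} (hq : P.primary e ∉ byz)
    (hk : (E.state k (P.primary e)).epoch = e) (hV : (E.state k (P.primary e)).selected = some V)
    {u : P.Rep} {cfg : Config P Op} (hep : (E.state i u).epoch = e)
    (h : (E.state i u).echoed = some cfg) : cfg = newConfig P e V := by
  have hg := (E.inv i u).echoed cfg h
  rw [hep] at hg
  obtain ⟨j, -, hs⟩ := E.sends_of_got hq hg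
  obtain ⟨h1, V', hV', rfl⟩ := hs.init_inv
  rw [selected_unique (hk.trans h1) hV hV', ← h1]

theorem readied_eq (hbyz : byz.card ≤ P.f) {e i k : ℕ} {V : Finset (EpochChange P Op)}
    (hq : P.primary e ∉ byz) (hk : (E.state k (P.primary e)).epoch = e)
    (hV : (E.state k (P.primary e)).selected = some V) {u : P.Rep} {cfg : Config P Op}
    (hep : (E.state i u).epoch = e) (h : (E.state i u).readied = some cfg) :
    cfg = newConfig P e V := by
  induction i using Nat.strong_induction_on generalizing u with
  | _ i ih =>
    have hquorum := (E.inv i u).readied cfg h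
    unfold RState.ReadyQuorum at hquorum
    rw [hep] at hquorum
    rcases hquorum with hquorum | hquorum
    · obtain ⟨w, hw, hg⟩ := hquorum.exists_correct hbyz (by omega)
      obtain ⟨j, hj, hs⟩ := E.sends_of_got hw hg
      exact echoed_eq hq hk hV hs.echo_inv.1.symm hs.echo_inv.2
    · obtain ⟨w, hw, hg⟩ := hquorum.exists_correct hbyz (by omega)
      obtain ⟨j, hj, hs⟩ := E.sends_of_got hw hg
      exact ih j hj hs.ready_inv.1.symm hs.ready_inv.2

namespace StableEpoch

variable {e : ℕ} {J : ℕ → ℕ}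

theorem epoch_le (h : E.StableEpoch e J) {n : ℕ} (hn : n ≤ 17) {u : P.Rep} (hu : u ∉ byz) :
    (E.state (J n) u).epoch ≤ e :=
  (E.epoch_mono (h.mono hn) u).trans (h.stay u hu)

theorem epoch_eq (h : E.StableEpoch e J) {n : ℕ} (h1 : 1 ≤ n) (hn : n ≤ 17) {u : P.Rep}
    (hu : u ∉ byz) : (E.state (J n) u).epoch = e := by
  refine le_antisymm (h.epoch_le hn hu) (le_trans ?_ (E.epoch_mono (h.mono h1) u))
  by_contra! hlt
  obtain ⟨W, hW, hWe⟩ := h.reached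
  have hcall : ∀ w ∈ W, w ≠ u ∧ (E.state (J 1) u).CalledBy w e := by
    intro w hw
    obtain ⟨hb, hle⟩ := hWe w hw
    have heq : (E.state (J 0) w).epoch = e := le_antisymm (h.epoch_le (by omega) hb) hle
    constructor
    · rintro rfl
      exact absurd hlt (not_lt.2 (hle.trans (E.epoch_mono (h.mono (Nat.zero_le 1)) w)))
    · obtain ⟨c, hc1, hc2, hs⟩ := exists_call (heq ▸ h.two_le : 2 ≤ (E.state (J 0) w).epoch)
      exact ⟨c, h.got 0 hb hu (hs u), hc1, hc2.trans heq⟩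
  obtain ⟨t, ht⟩ := h.quiet 1 hu
  set A := {e' | (E.state (J 1) u).epoch < e' ∧ ∃ w, w ≠ u ∧ (E.state (J 1) u).CalledBy w e'}
    with hA
  have hne : A.Nonempty := by
    obtain ⟨w, hw⟩ := Finset.card_pos.1 (show 0 < W.card by omega)
    exact ⟨e, hlt, w, hcall w hw⟩
  exact ht _ (.callFollow (sInf A)
    ⟨W, hW, fun w hw => ⟨(hcall w hw).1, e, hlt, (hcall w hw).2⟩⟩
    ⟨Nat.sInf_mem hne, fun _ hx => Nat.sInf_le hx⟩)

theorem sameEpoch (h : E.StableEpoch e J) {n m : ℕ} (h1 : 1 ≤ n) (hnm : n ≤ m) (hm : m ≤ 17)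
    {u : P.Rep} (hu : u ∉ byz) : (E.state (J n) u).SameEpoch (E.state (J m) u) :=
  (E.evolves (h.mono hnm) u).same
    ((h.epoch_eq (h1.trans hnm) hm hu).trans (h.epoch_eq h1 (hnm.trans hm) hu).symm)

theorem got_mono (h : E.StableEpoch e J) {n m : ℕ} (hnm : n ≤ m) {u w : P.Rep} {x : Msg P Op}
    (hg : (E.state (J n) u).Got w x) : (E.state (J m) u).Got w x :=
  hg.mono (E.evolves (h.mono hnm) u).inbox

theorem exists_selected (h : E.StableEpoch e J) (hbyz : byz.card ≤ P.f) :
    ∃ V, (E.state (J 2) (P.primary e)).selected = some V := by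
  have hq := h.primary
  have hep := h.epoch_eq (n := 2) (by omega) (by omega) hq
  by_contra hnone
  replace hnone : (E.state (J 2) (P.primary e)).selected = none := by
    rcases hc : (E.state (J 2) (P.primary e)).selected with _ | V
    · rfl
    · exact absurd ⟨V, hc⟩ hnone
  by_cases ha : (E.state (J 2) (P.primary e)).active
  · rcases (E.inv _ _).entered ha with ⟨h1, -⟩ | ⟨-, V, hg, -⟩
    · have := h.two_le; omega
    · rw [hep] at hg
      obtain ⟨j, hj, hs⟩ := E.sends_of_got hq hg
      obtain ⟨h1, h2⟩ := hs.newEpoch_inv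
      have := ((E.evolves hj.le _).same (hep.trans h1)).selected V h2
      rw [hnone] at this
      cases this
  · have hcall : ∀ w, w ∉ byz → ∃ c, c.sender = w ∧ c.epoch = e ∧
        (E.state (J 2) (P.primary e)).Got w (.epochChange c) := by
      intro w hw
      have hew := h.epoch_eq (n := 1) (by omega) (by omega) hw
      obtain ⟨c, hc1, hc2, hs⟩ := exists_call (hew ▸ h.two_le : 2 ≤ (E.state (J 1) w).epoch)
      exact ⟨c, hc1, hc2.trans hew, h.got 1 hw hq (hs _)⟩
    have : Nonempty (EpochChange P Op) := ⟨⟨0, 0, ∅, ∅, ∅, ∅⟩⟩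
    choose! c hc1 hc2 hc3 using hcall
    obtain ⟨W, hqW, hW, hcard⟩ := Finset.exists_subsuperset_card_eq
      (s := {P.primary e}) (t := byzᶜ) (n := 2 * P.f + 1) (by simpa using hq)
      (by simp) (card_correct hbyz)
    have hWc : ∀ w ∈ W, w ∉ byz := fun w hw => Finset.mem_compl.1 (hW hw)
    have hinj : Set.InjOn c W := fun w hw w' hw' heq => by
      rw [← hc1 w (hWc w hw), heq, hc1 w' (hWc w' hw')]
    obtain ⟨t, ht⟩ := h.quiet 2 hq
    refine ht _ (.select (W.image c) ha (by rw [hep]) hnone ⟨?_, ?_, ?_⟩ ?_ ?_)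
    · rw [Finset.card_image_of_injOn hinj, hcard]
    · rintro x hx
      obtain ⟨w, hw, rfl⟩ := Finset.mem_image.1 hx
      rw [hep, hc2 w (hWc w hw)]
    · rintro x hx y hy hxy
      obtain ⟨w, hw, rfl⟩ := Finset.mem_image.1 hx
      obtain ⟨w', hw', rfl⟩ := Finset.mem_image.1 hy
      rw [hc1 w (hWc w hw), hc1 w' (hWc w' hw')] at hxy
      rw [hxy]
    · rintro x hx
      obtain ⟨w, hw, rfl⟩ := Finset.mem_image.1 hx
      rw [hc1 w (hWc w hw)]
      exact hc3 w (hWc w hw)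
    · exact ⟨_, Finset.mem_image_of_mem c (hqW (Finset.mem_singleton_self _)), hc1 _ hq⟩

/-- After six message delays, every correct replica has entered the epoch. -/
theorem active_six (h : E.StableEpoch e J) (hbyz : byz.card ≤ P.f) {u : P.Rep} (hu : u ∉ byz) :
    (E.state (J 6) u).active := by
  have hq := h.primary
  obtain ⟨V, hV⟩ := h.exists_selected hbyz
  have hepq := h.epoch_eq (n := 2) (by omega) (by omega) hq
  have hecho : ∀ w, w ∉ byz → (E.state (J 3) w).echoed = some (newConfig P e V) := by
    intro w hw
    have hep := h.epoch_eq (n := 3) (by omega) (by omega) hw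
    rcases hc : (E.state (J 3) w).echoed with _ | cfg
    · obtain ⟨t, ht⟩ := h.quiet 3 hw
      have hg := h.got 2 hq hw (.init w V hV)
      rw [hepq] at hg
      exact absurd (.echo (newConfig P e V) hc (by rw [hep]; exact hg)) (ht _)
    · rw [echoed_eq hq hepq hV hep hc]
  have hready : ∀ w, w ∉ byz → (E.state (J 4) w).readied = some (newConfig P e V) := by
    intro w hw
    have hep := h.epoch_eq (n := 4) (by omega) (by omega) hw
    rcases hc : (E.state (J 4) w).readied with _ | cfg
    · obtain ⟨t, ht⟩ := h.quiet 4 hw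
      refine absurd (.ready (newConfig P e V) hc (Or.inl ?_)) (ht _)
      rw [hep]
      refine atLeast_of_correct hbyz le_rfl fun x hx => ?_
      have hg := h.got 3 hx hw (.echo w _ (hecho x hx))
      rwa [h.epoch_eq (n := 3) (by omega) (by omega) hx] at hg
    · rw [readied_eq hbyz hq hepq hV hep hc]
  have hdel : ∀ n, 5 ≤ n → n ≤ 17 → ∀ w, w ∉ byz →
      (E.state (J n) w).Delivered (newConfig P e V) := by
    intro n h5 hn w hw
    unfold RState.Delivered
    rw [h.epoch_eq (by omega) hn hw]
    refine atLeast_of_correct hbyz le_rfl fun x hx => ?_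
    have hg := h.got 4 hx hw (.ready w _ (hready x hx))
    rw [h.epoch_eq (n := 4) (by omega) (by omega) hx] at hg
    exact h.got_mono h5 hg
  have hV5 := (h.sameEpoch (n := 2) (m := 5) (by omega) (by omega) (by omega) hq).selected V hV
  have hepq5 := h.epoch_eq (n := 5) (by omega) (by omega) hq
  have hg := h.got 5 hq hu (.newEpoch u V hV5 (by rw [hepq5]; exact hdel 5 le_rfl (by omega) _ hq))
  rw [hepq5] at hg
  by_contra ha
  have hep := h.epoch_eq (n := 6) (by omega) (by omega) hu
  obtain ⟨t, ht⟩ := h.quiet 6 hu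
  refine ht _ (.enter V ha ?_ ?_ ?_)
  · rw [hep]; exact hg
  · rw [hep, ← hepq5]; exact ((E.inv _ _).selected V hV5).1
  · rw [hep]; exact hdel 6 (by omega) (by omega) u hu

theorem active (h : E.StableEpoch e J) (hbyz : byz.card ≤ P.f) {n : ℕ} (h6 : 6 ≤ n) (hn : n ≤ 17)
    {u : P.Rep} (hu : u ∉ byz) : (E.state (J n) u).active :=
  (h.sameEpoch (by omega) h6 hn hu).active (h.active_six hbyz hu)

variable {cfg : Config P Op}

theorem isConfig (h : E.StableEpoch e J) (hbyz : byz.card ≤ P.f) {n : ℕ} (h6 : 6 ≤ n)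
    (hn : n ≤ 17) {u : P.Rep} (hu : u ∉ byz) : E.IsConfig e (E.state (J n) u).cfg :=
  ⟨J n, u, hu, h.active hbyz h6 hn hu, h.epoch_eq (by omega) hn hu, rfl⟩

theorem cfg_eq (h : E.StableEpoch e J) (hbyz : byz.card ≤ P.f) (hcfg : E.IsConfig e cfg) {n : ℕ}
    (h6 : 6 ≤ n) (hn : n ≤ 17) {u : P.Rep} (hu : u ∉ byz) : (E.state (J n) u).cfg = cfg :=
  IsConfig.unique hbyz (h.isConfig hbyz h6 hn hu) hcfg

/-- What all correct replicas accept from a correct leader is committed four delays later. -/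
theorem commits (h : E.StableEpoch e J) (hbyz : byz.card ≤ P.f) (hcfg : E.IsConfig e cfg) {n : ℕ}
    (h6 : 6 ≤ n) (hn : n + 4 ≤ 17) {v : P.Rep} (hv : v ∉ byz) {sn : ℕ} (hsn : sn ∈ cfg.own v)
    {x : Option (Request Client Op)}
    (hacc : ∀ u, u ∉ byz → (E.state (J n) u).accepted sn = some x) {u : P.Rep} (hu : u ∉ byz) :
    (⟨e, sn, x⟩ : Entry Client Op) ∈ (E.state (J (n + 4)) u).certs := by
  have hep : ∀ m, 6 ≤ m → m ≤ 17 → ∀ w, w ∉ byz → (E.state (J m) w).epoch = e :=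
    fun m h6 hm w hw => h.epoch_eq (by omega) hm hw
  have hact : ∀ m, 6 ≤ m → m ≤ 17 → ∀ w, w ∉ byz → (E.state (J m) w).active :=
    fun m h6 hm w hw => h.active hbyz h6 hm hw
  have hown : ∀ m, 6 ≤ m → m ≤ 17 → ∀ w, w ∉ byz → sn ∈ (E.state (J m) w).cfg.own v :=
    fun m h6 hm w hw => by rwa [h.cfg_eq hbyz hcfg h6 hm hw]
  have hprep : ∀ w, w ∉ byz → (E.state (J (n + 1)) v).Got w (.prepare ⟨e, sn, x⟩) := by
    intro w hw
    have hs := RState.Sends.prepare (u := w) v sn x (hact n h6 (by omega) w hw) (hacc w hw)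
      (hown n h6 (by omega) w hw)
    rw [hep n h6 (by omega) w hw] at hs
    exact h.got n hw hv hs
  have hacc' : (E.state (J (n + 1)) v).accepted sn = some x :=
    (h.sameEpoch (by omega) (Nat.le_succ n) (by omega) hv).accepted
      (hact n h6 (by omega) v hv) sn x (hacc v hv)
  have hpc : ∀ w, w ∉ byz → (⟨e, sn, x⟩ : Entry Client Op) ∈ (E.state (J (n + 2)) w).prepared := by
    intro w hw
    have hg := h.got (n + 1) hv hw (.preparedCert w ⟨e, sn, x⟩
      (hact (n + 1) (by omega) (by omega) v hv) (hep (n + 1) (by omega) (by omega) v hv).symm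
      (hown (n + 1) (by omega) (by omega) v hv) hacc' (atLeast_of_correct hbyz le_rfl hprep))
    by_contra hmem
    obtain ⟨t, ht⟩ := h.quiet (n + 2) hw
    exact ht _ (.acceptPrepared v ⟨e, sn, x⟩ (hact (n + 2) (by omega) (by omega) w hw) hg
      (hep (n + 2) (by omega) (by omega) w hw).symm (hown (n + 2) (by omega) (by omega) w hw) hmem)
  have hcom : ∀ w, w ∉ byz → (E.state (J (n + 3)) v).Got w (.commit ⟨e, sn, x⟩) := fun w hw =>
    h.got (n + 2) hw hv (.commit v ⟨e, sn, x⟩ (hact (n + 2) (by omega) (by omega) w hw)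
      (hep (n + 2) (by omega) (by omega) w hw).symm (hpc w hw)
      (hown (n + 2) (by omega) (by omega) w hw))
  have hg := h.got (n + 3) hv hu (.commitCert u ⟨e, sn, x⟩
    (hact (n + 3) (by omega) (by omega) v hv) (hep (n + 3) (by omega) (by omega) v hv).symm
    (hown (n + 3) (by omega) (by omega) v hv) (atLeast_of_correct hbyz le_rfl hcom))
  exact (E.inv _ u).commitCert _ _ hg

/-- Hanging sequence numbers of correct leaders are committed. -/
theorem commits_hang (h : E.StableEpoch e J) (hbyz : byz.card ≤ P.f) (hcfg : E.IsConfig e cfg)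
    {v : P.Rep} (hv : v ∉ byz) {sn : ℕ} (hsn : sn ∈ cfg.own v) {x : Option (Request Client Op)}
    (hx : cfg.hang sn = some x) {u : P.Rep} (hu : u ∉ byz) :
    (⟨e, sn, x⟩ : Entry Client Op) ∈ (E.state (J 10) u).certs := by
  refine h.commits hbyz hcfg (n := 6) le_rfl (by omega) hv hsn (fun w hw => ?_) hu
  refine (E.inv _ w).hang (h.active_six hbyz hw) sn x ?_
  rwa [h.cfg_eq hbyz hcfg le_rfl (by omega) hw]

/-- The watermarks of a correct leader pass its hanging sequence numbers. -/
theorem lt_low (h : E.StableEpoch e J) (hbyz : byz.card ≤ P.f) (hk : 1 ≤ P.k)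
    (hcfg : E.IsConfig e cfg) {v : P.Rep} (hv : v ∉ byz) {l₁ l₂ : List ℕ}
    (hown : cfg.own v = l₁ ++ l₂) (hl₁ : ∀ x ∈ l₁, cfg.hang x ≠ none) {n : ℕ} (h12 : 12 ≤ n)
    (hn : n ≤ 17) {u : P.Rep} (hu : u ∉ byz) :
    l₁.length < (E.state (J n) u).low v + 2 * P.k := by
  set L := P.k * (l₁.length / P.k) with hL
  have hdiv : L + l₁.length % P.k = l₁.length := Nat.div_add_mod _ _
  have hmod : l₁.length % P.k < P.k := Nat.mod_lt _ hk
  by_cases hL0 : L = 0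
  · omega
  choose! val hval using fun x hx => Option.ne_none_iff_exists'.1 (hl₁ x hx)
  set c : Ckpt P Op := ⟨e, v, (l₁.take L).map (fun sn => (sn, val sn))⟩ with hc
  have hlen : c.log.length = L := by simp [hc]; omega
  have hck : ∀ w, w ∉ byz → (E.state (J 11) v).Got w (.checkpoint c) := by
    intro w hw
    have hep := h.epoch_eq (n := 10) (by omega) (by omega) hw
    refine h.got 10 hw hv (.checkpoint c (h.active hbyz (by omega) (by omega) hw) hep.symm
      (fun hnil => hL0 (by rw [← hlen, hnil]; rfl)) (by rw [hlen]; exact ⟨_, rfl⟩) ?_)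
    rw [h.cfg_eq hbyz hcfg (by omega) (by omega) hw, hlen, hep]
    simp only [hc]
    rw [hown, List.take_append_of_le_length (by omega), List.forall₂_map_right_iff,
      List.forall₂_same]
    intro sn hsn
    have hmem := List.mem_of_mem_take hsn
    exact ⟨rfl, h.commits_hang hbyz hcfg hv (by rw [hown]; simp [hmem]) (hval sn hmem) hw⟩
  have hg := h.got 11 hv hu (.checkpointCert u c (h.active hbyz (by omega) (by omega) hv)
    (h.epoch_eq (by omega) (by omega) hv).symm rfl (atLeast_of_correct hbyz le_rfl hck))
  have hst := (E.evolves (h.mono h12) u).stable ((E.inv _ u).checkpointCert _ _ hg)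
  have hlow : L ≤ (E.state (J n) u).low v := by
    rw [← hlen]
    refine Finset.le_sup (f := fun c : Ckpt P Op => c.log.length) (Finset.mem_filter.2 ⟨hst, ?_, rfl⟩)
    exact (h.epoch_eq (by omega) hn hu).symm
  omega

end StableEpoch

/-- A stable checkpoint of an epoch covers only committed sequence numbers. -/
theorem certs_of_lt_low (hbyz : byz.card ≤ P.f) {e i : ℕ} {cfg : Config P Op}
    (hcfg : E.IsConfig e cfg) {u v : P.Rep} (hep : (E.state i u).epoch = e) {sn : ℕ}
    {l₁ l₂ : List ℕ} (hown : cfg.own v = l₁ ++ sn :: l₂)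
    (hlow : l₁.length < (E.state i u).low v) :
    ∃ j, ∃ w ∉ byz, ∃ x, (⟨e, sn, x⟩ : Entry Client Op) ∈ (E.state j w).certs := by
  obtain ⟨c, hc, hlt⟩ := (Finset.lt_sup_iff).1 hlow
  obtain ⟨hst, hce, rfl⟩ := Finset.mem_filter.1 hc
  obtain ⟨U, hU, hs⟩ := (E.genuineAt i u).2 c hst
  obtain ⟨w, hwU, hw⟩ := exists_correct hbyz (W := U) (by omega)
  obtain ⟨j, -, z, hs⟩ := hs w hwU hw
  obtain ⟨ha, he, hall⟩ := hs.checkpoint_inv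
  have hej : (E.state j w).epoch = e := by rw [← he, hce, hep]
  rw [IsConfig.unique hbyz ⟨j, w, hw, ha, hej, rfl⟩ hcfg, hown, hej] at hall
  have hlen := hall.length_eq
  have hmem : sn ∈ (l₁ ++ sn :: l₂).take c.log.length := by
    rw [List.take_append, List.mem_append]
    right
    obtain ⟨k, hk⟩ : ∃ k, c.log.length - l₁.length = k + 1 := ⟨c.log.length - l₁.length - 1, by omega⟩
    rw [hk]
    simp
  obtain ⟨n, hn, hget⟩ := List.mem_iff_getElem.1 hmem
  have := (List.forall₂_iff_get.1 hall).2 n hn (hlen ▸ hn)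
  simp only [List.get_eq_getElem, hget] at this
  exact ⟨j, w, hw, _, this.2⟩


/-! ### Success of an epoch with a correct primary -/

variable (E) in
/-- A correct replica holds a commit-certificate of epoch `e` for `sn`. -/
def Certified (e sn : ℕ) : Prop :=
  ∃ j, ∃ w ∉ byz, ∃ x, (⟨e, sn, x⟩ : Entry Client Op) ∈ (E.state j w).certs

theorem Certified.accepted (hbyz : byz.card ≤ P.f) {e sn : ℕ} (h : E.Certified e sn)
    {cfg : Config P Op} (hcfg : E.IsConfig e cfg) {v : P.Rep} (hv : v ∉ byz)
    (hsn : sn ∈ cfg.own v) : ∃ j, ∃ w ∉ byz, ∃ x,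
      (⟨e, sn, x⟩ : Entry Client Op) ∈ (E.state j w).certs ∧ ∃ k, (E.state k v).active ∧
        (E.state k v).epoch = e ∧ (E.state k v).accepted sn = some x := by
  obtain ⟨j, w, hw, x, hx⟩ := h
  obtain ⟨k, -, hk⟩ := accepted_of_supported hbyz hv hcfg hsn ((E.genuineAt j w).1 _ hx)
  exact ⟨j, w, hw, x, hx, k, hk⟩

/-- A correct leader accepts for its fresh sequence numbers only what it proposed. -/
theorem proposed_of_accepted (hbyz : byz.card ≤ P.f) {e : ℕ} {cfg : Config P Op}
    (hcfg : E.IsConfig e cfg) {u v : P.Rep} (hu : u ∉ byz) (hv : v ∉ byz) {sn : ℕ}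
    (hsn : sn ∈ cfg.own v)
    (hhang : cfg.hang sn = none) {i : ℕ} (ha : (E.state i u).active)
    (hep : (E.state i u).epoch = e) {x : Option (Request Client Op)}
    (hx : (E.state i u).accepted sn = some x) :
    ∃ r, x = some r ∧ ∃ j < i, (E.state j v).active ∧ (E.state j v).epoch = e ∧
      (E.state j v).proposed sn = some r := by
  have hc := IsConfig.unique hbyz ⟨i, u, hu, ha, hep, rfl⟩ hcfg
  rcases (E.inv i u).accepted ha sn x hx with h | ⟨w, hw, hg⟩
  · rw [hc, hhang] at h; cases h
  · rw [hc] at hw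
    obtain rfl := hcfg.sound.own_unique hw hsn
    obtain ⟨j, hj, hs⟩ := E.sends_of_got hv hg
    obtain ⟨h1, h2, r, hr, h3⟩ := hs.prePrepare_inv
    exact ⟨r, hr, j, hj, h1, h2.symm.trans hep, h3⟩

theorem proposed_unique {i j : ℕ} {u : P.Rep} {sn : ℕ} {r r' : Request Client Op}
    (he : (E.state i u).epoch = (E.state j u).epoch) (ha : (E.state i u).active)
    (ha' : (E.state j u).active) (h : (E.state i u).proposed sn = some r)
    (h' : (E.state j u).proposed sn = some r') : r = r' := by
  rcases E.sameEpoch_total he with hs | hs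
  · have := hs.proposed ha sn r h
    rw [h'] at this
    exact (Option.some.inj this).symm
  · have := hs.proposed ha' sn r' h'
    rw [h] at this
    exact Option.some.inj this

/-- The first fresh sequence number of a correct leader is committed, unless the leader has nothing
to propose. -/
theorem StableEpoch.certified_fresh {e : ℕ} {J : ℕ → ℕ} (h : E.StableEpoch e J)
    (hbyz : byz.card ≤ P.f) (hk : 1 ≤ P.k) {cfg : Config P Op} (hcfg : E.IsConfig e cfg)
    {v : P.Rep} (hv : v ∉ byz) {l₁ l₂ : List ℕ} {sn : ℕ} (hown : cfg.own v = l₁ ++ sn :: l₂)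
    (hl₁ : ∀ x ∈ l₁, cfg.hang x ≠ none) (hsn : cfg.hang sn = none) :
    E.Certified e sn ∨ ¬ (E.state (J 12) v).Used sn ∧
      ∀ r ∈ (E.state (J 12) v).queue, ¬ (E.state (J 12) v).Eligible v r := by
  have hact := fun n h6 hn u hu => h.active hbyz (n := n) h6 hn (u := u) hu
  have hcfg' := fun n h6 hn u hu => h.cfg_eq hbyz hcfg (n := n) h6 hn (u := u) hu
  have hep := fun n h1 hn u hu => h.epoch_eq (n := n) h1 hn (u := u) hu
  have hmem : sn ∈ cfg.own v := by rw [hown]; simp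
  rcases hp : (E.state (J 12) v).proposed sn with _ | r
  · right
    have hfresh : ¬ (E.state (J 12) v).Used sn := by
      rintro (hu | hu)
      · rw [hcfg' 12 (by omega) (by omega) v hv] at hu; exact hu hsn
      · exact hu hp
    refine ⟨hfresh, ?_⟩
    by_contra! hex
    obtain ⟨r, hr, hel⟩ := hex
    obtain ⟨r, hr⟩ := Option.isSome_iff_exists.1 (List.find?_isSome
      (p := fun r => decide ((E.state (J 12) v).Eligible v r)) |>.2 ⟨r, hr, decide_eq_true hel⟩)
    obtain ⟨hel, q₁, q₂, hq, hq₁⟩ := List.find?_eq_some_iff_append.1 hr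
    obtain ⟨t, ht⟩ := h.quiet 12 hv
    refine ht _ (.propose sn r l₁ l₂ q₁ q₂ (hact 12 (by omega) (by omega) v hv) ?_
      (fun x hx => Or.inl ?_) hfresh ?_ hq (fun x hx => ?_) (of_decide_eq_true hel))
    · rw [hcfg' 12 (by omega) (by omega) v hv, hown]
    · rw [hcfg' 12 (by omega) (by omega) v hv]; exact hl₁ x hx
    · exact h.lt_low hbyz hk hcfg hv hown hl₁ le_rfl (by omega) hv
    · simpa using hq₁ x hx
  · left
    have hep12 := hep 12 (by omega) (by omega) v hv
    have hact12 := hact 12 (by omega) (by omega) v hv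
    have hbucket : cfg.bucket (P.hash r.client) = v := by
      obtain ⟨j, -, he, hpr⟩ := proposed_origin hact12 hp
      rw [← IsConfig.unique hbyz ⟨j, v, hv, hpr.active, he.trans hep12, rfl⟩ hcfg]
      exact hpr.eligible.1
    by_cases hlow : ∃ u, u ∉ byz ∧ l₁.length < (E.state (J 13) u).low v
    · obtain ⟨u, hu, hlow⟩ := hlow
      exact certs_of_lt_low hbyz hcfg (hep 13 (by omega) (by omega) u hu) hown hlow
    · have hacc : ∀ u, u ∉ byz → (E.state (J 13) u).accepted sn = some (some r) := by
        intro u hu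
        have hep13 := hep 13 (by omega) (by omega) u hu
        have hact13 := hact 13 (by omega) (by omega) u hu
        have hg := h.got 12 hv hu (.prePrepare u sn r hact12 hp)
        rw [hep12] at hg
        rcases hc : (E.state (J 13) u).accepted sn with _ | x
        · obtain ⟨t, ht⟩ := h.quiet 13 hu
          refine absurd (RState.Act.acceptPrePrepare v ⟨e, sn, some r⟩ r l₁ l₂ hact13 hg
            hep13.symm hc ?_ (not_lt.1 fun hlt => hlow ⟨u, hu, hlt⟩) ?_ rfl ?_) (ht _)
          · rw [hcfg' 13 (by omega) (by omega) u hu, hown]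
          · exact h.lt_low hbyz hk hcfg hv hown hl₁ (by omega) (by omega) hu
          · rw [hcfg' 13 (by omega) (by omega) u hu, hbucket]
        · obtain ⟨r', rfl, j, -, ha, he, hr'⟩ :=
            proposed_of_accepted hbyz hcfg hu hv hmem hsn hact13 hep13 hc
          rw [proposed_unique (he.trans hep12.symm) ha hact12 hr' hp]
      exact ⟨_, v, hv, _, h.commits hbyz hcfg (n := 13) (by omega) le_rfl hv hmem hacc hv⟩

/-- In epoch `e`, every correct leader commits its hanging sequence numbers, and its first fresh one
unless it has nothing to propose. -/
structure Success (E : Execution P Op byz good) (e : ℕ) : Prop where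
  entered : ∀ u, u ∉ byz → ∃ i, (E.state i u).active ∧ (E.state i u).epoch = e
  hang : ∀ {cfg}, E.IsConfig e cfg → ∀ {v}, v ∉ byz → ∀ {sn}, sn ∈ cfg.own v →
    cfg.hang sn ≠ none → E.Certified e sn
  fresh : ∀ {cfg}, E.IsConfig e cfg → ∀ {v}, v ∉ byz → ∀ {l₁ sn l₂},
    cfg.own v = l₁ ++ sn :: l₂ → (∀ x ∈ l₁, cfg.hang x ≠ none) → cfg.hang sn = none →
      E.Certified e sn ∨ ∃ i, (E.state i v).active ∧ (E.state i v).epoch = e ∧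
        ¬ (E.state i v).Used sn ∧ ∀ r ∈ (E.state i v).queue, ¬ (E.state i v).Eligible v r

theorem success_of_finished (hbyz : byz.card ≤ P.f) {e i : ℕ} {w : P.Rep} (hw : w ∉ byz)
    (ha : (E.state i w).active) (hep : (E.state i w).epoch = e)
    (hfin : ∀ v, (E.state i w).Finished v) : E.Success e := by
  have hcfg : E.IsConfig e (E.state i w).cfg := ⟨i, w, hw, ha, hep, rfl⟩
  have key : ∀ {cfg : Config P Op}, E.IsConfig e cfg → ∀ {v : P.Rep}, ∀ {sn : ℕ},
      sn ∈ cfg.own v → E.Certified e sn := by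
    intro cfg hcfg' v sn hsn
    rw [IsConfig.unique hbyz hcfg' hcfg] at hsn
    obtain ⟨x, hx⟩ := hfin v sn hsn
    exact ⟨i, w, hw, x, hep ▸ hx⟩
  refine ⟨fun u hu => ?_, fun hc _ _ _ hsn _ => key hc hsn,
    fun hc v _ l₁ sn l₂ hown _ _ => Or.inl (key hc (v := v) (by rw [hown]; simp))⟩
  obtain ⟨l₁, sn, l₂, hown, -⟩ := hcfg.sound.own_split u
  have hsn : sn ∈ (E.state i w).cfg.own u := by rw [hown]; simp
  obtain ⟨-, -, -, -, -, k, h1, h2, -⟩ := (key hcfg hsn).accepted hbyz hcfg hu hsn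
  exact ⟨k, h1, h2⟩

theorem StableEpoch.success {e : ℕ} {J : ℕ → ℕ} (h : E.StableEpoch e J)
    (hbyz : byz.card ≤ P.f) (hk : 1 ≤ P.k) : E.Success e where
  entered u hu := ⟨J 6, h.active_six hbyz hu, h.epoch_eq (by omega) (by omega) hu⟩
  hang hcfg v hv sn hsn hx := by
    obtain ⟨x, hx⟩ := Option.ne_none_iff_exists'.1 hx
    exact ⟨_, v, hv, x, h.commits_hang hbyz hcfg hv hsn hx hv⟩
  fresh hcfg v hv l₁ sn l₂ hown hl₁ hsn :=
    (h.certified_fresh hbyz hk hcfg hv hown hl₁ hsn).imp_right fun hn =>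
      ⟨J 12, h.active hbyz (by omega) (by omega) hv, h.epoch_eq (by omega) (by omega) hv, hn⟩

theorem success (hP : P.WellFormed) (hTe : 18 * P.Δ ≤ P.Te) (hT : 18 * P.Δ ≤ P.T)
    (hTp : 18 * P.Δ ≤ P.Tp) (hbyz : byz.card ≤ P.f) {e j₀ : ℕ} (he : 2 ≤ e)
    (hq : P.primary e ∉ byz) (hj₀ : E.Reached e j₀) (hmin : ∀ i, E.Reached e i → j₀ ≤ i)
    (hG : E.GST ≤ E.time j₀) : E.Success e := by
  have hΔ := hP.delta_pos
  have h0 := E.time_nonneg j₀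
  have hpos : ∀ n : ℕ, 0 ≤ n * P.Δ := fun n => by positivity
  have hD : ∀ n : ℕ, 0 ≤ E.time j₀ + n * P.Δ := fun n => add_nonneg h0 (hpos n)
  set J : ℕ → ℕ := fun n => E.upTo (E.time j₀ + n * P.Δ) with hJ
  by_cases hstay : ∀ u, u ∉ byz → (E.state (J 17) u).epoch ≤ e
  · refine StableEpoch.success (J := J) ⟨?_, ?_, ?_, he, ?_, hstay, hq⟩ hbyz hP.k_pos
    · intro n m hnm
      refine upTo_mono (hD n) ?_
      gcongr
    · intro n u w m hu hw hs
      have := got_of_sends (hD n) (by have := hpos n; linarith) hu hw hs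
      have heq : E.time j₀ + n * P.Δ + P.Δ = E.time j₀ + (n + 1 : ℕ) * P.Δ := by push_cast; ring
      rwa [heq] at this
    · exact fun n u hu => ⟨_, not_act (hD n) hu⟩
    · exact AtLeast.mono le_rfl hj₀ fun w hw =>
        ⟨hw.1, hw.2.trans (E.epoch_mono (le_upTo (by simp)) w)⟩
  · push Not at hstay
    obtain ⟨u, hu, hgt⟩ := hstay
    obtain ⟨i, w, hw, ha, hep, hfin⟩ := exists_finished hbyz he hmin (t := (17 : ℕ) * P.Δ)
      (by push_cast; linarith) (hpos 17) (by push_cast; linarith) (by push_cast; linarith)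
      (time_upTo_le (hD 17)) hu hgt
    exact success_of_finished hbyz hw ha hep hfin

/-- All late epochs with a correct primary succeed. -/
theorem eventually_success (hP : P.WellFormed) (hTe : 18 * P.Δ ≤ P.Te) (hT : 18 * P.Δ ≤ P.T)
    (hTp : 18 * P.Δ ≤ P.Tp) (hbyz : byz.card ≤ P.f) :
    ∀ᶠ e in Filter.atTop, P.primary e ∉ byz → E.Success e := by
  obtain ⟨N, hN⟩ := (E.time_unbounded.eventually_ge_atTop E.GST).exists
  refine Filter.eventually_atTop.2
    ⟨2 + Finset.univ.sup (fun u => (E.state N u).epoch), fun e he hq => ?_⟩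
  have hex : ∃ i, E.Reached e i := by
    obtain ⟨i, hi⟩ := exists_le_epoch (E := E) hbyz e
    exact ⟨i, atLeast_of_correct hbyz (by omega) fun w hw => ⟨hw, hi w hw⟩⟩
  refine success hP hTe hT hTp hbyz (by omega) hq (Nat.find_spec hex)
    (fun i hi => Nat.find_min' hex hi) (hN.trans (E.time_mono ?_))
  by_contra! hlt
  obtain ⟨w, -, -, hw⟩ := (Nat.find_spec hex).exists_correct hbyz le_rfl
  have h1 := hw.trans (E.epoch_mono hlt.le w)
  have h2 : (E.state N w).epoch ≤ Finset.univ.sup (fun u => (E.state N u).epoch) :=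
    Finset.le_sup (f := fun u => (E.state N u).epoch) (Finset.mem_univ w)
  omega

/-! ### Dissemination of commit-certificates -/

theorem exists_mem_certs {i : ℕ} {u w : P.Rep} (hu : u ∉ byz) (hw : w ∉ byz)
    (hent : ∀ N, ∃ e ≥ N, ∃ k, (E.state k u).active ∧ (E.state k u).epoch = e)
    {d : Entry Client Op} (hd : d ∈ (E.state i w).certs) : ∃ j, d ∈ (E.state j u).certs := by
  obtain ⟨e, he, k, ha, hep⟩ := hent ((E.state i u).epoch + 2)
  obtain ⟨l, hl, -⟩ := E.network k u w _ hu hw (.fetch w ha (by omega))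
  obtain ⟨j, hj, hs⟩ := E.authentic l u w _ hl hu
  have hij : i ≤ l := by
    by_contra! hlt
    have h1 := hs.fetch_inv
    have h2 := E.epoch_mono (show j ≤ i by omega) u
    omega
  have hsup : (u, (E.state l w).certs) ∈ (E.state (l + 1) w).supplied := by
    rw [(E.on_deliver l _ _ _ hl).1]
    simp [RState.receive]
  obtain ⟨j', hj'⟩ := exists_got_of_sends hw hu (.supply u _ hsup)
  exact ⟨j', (E.inv j' u).supply _ _ hj' ((E.evolves hij w).certs hd)⟩

/-! ### Liveness -/

theorem mem_of_append_cons_eq {α : Type*} {a b c d : List α} {x y : α}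
    (h : a ++ x :: b = c ++ y :: d) : x ∈ c ∨ x = y ∨ y ∈ a := by
  rw [List.append_eq_append_iff] at h
  rcases h with ⟨l, rfl, h⟩ | ⟨l, rfl, h⟩
  · rcases l with _ | ⟨z, l⟩
    · simp at h; simp [h.1]
    · simp at h; simp [h.1]
  · rcases l with _ | ⟨z, l⟩
    · simp at h; simp [h.1]
    · simp at h; simp [h.1]

theorem hasCommitted_mono {i j : ℕ} (hij : i ≤ j) {u : P.Rep} {r : Request Client Op}
    (h : (E.state i u).HasCommitted r) : (E.state j u).HasCommitted r := by
  obtain ⟨d, hd, hr⟩ := h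
  exact ⟨d, (E.evolves hij u).certs hd, hr⟩

/-- If `v` serves the bucket of `r` and `r` is neither committed nor hanging, then `r` is eligible
until `v` proposes for its first fresh sequence number. -/
theorem eligible_of_fresh (hbyz : byz.card ≤ P.f) {e : ℕ} {cfg : Config P Op}
    (hcfg : E.IsConfig e cfg) {v : P.Rep} (hv : v ∉ byz) {l₁ l₂ : List ℕ} {sn : ℕ}
    (hown : cfg.own v = l₁ ++ sn :: l₂) (hl₁ : ∀ x ∈ l₁, cfg.hang x ≠ none)
    {r : Request Client Op} (hr : cfg.bucket (P.hash r.client) = v)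
    (hhang : ∀ x, cfg.hang x ≠ some (some r)) {i : ℕ} (ha : (E.state i v).active)
    (hep : (E.state i v).epoch = e) (hsn : ¬ (E.state i v).Used sn)
    (hcom : ¬ (E.state i v).HasCommitted r) : (E.state i v).Eligible v r := by
  have hc := IsConfig.unique hbyz ⟨i, v, hv, ha, hep, rfl⟩ hcfg
  refine ⟨by rw [hc, hr], hcom, by rwa [hc], fun x hx => ?_⟩
  obtain ⟨l₁', l₂', h1, h2, h3⟩ := (E.inv i v).proposed ha x (by simp [hx])
  rw [hc] at h1 h3
  rcases mem_of_append_cons_eq (h1.symm.trans hown) with h | rfl | h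
  · exact hl₁ x h h3
  · exact hsn (Or.inr (by simp [hx]))
  · exact hsn (h2 sn h)

theorem exists_hasCommitted (hP : P.WellFormed) (hTe : 18 * P.Δ ≤ P.Te) (hT : 18 * P.Δ ≤ P.T)
    (hTp : 18 * P.Δ ≤ P.Tp) (hbyz : byz.card ≤ P.f) {i : ℕ} {r : Request Client Op}
    (hsub : E.event i = .submit r) (hr : r.client ∈ good) {u : P.Rep} (hu : u ∉ byz) :
    ∃ j, (E.state j u).HasCommitted r := by
  have hsucc := eventually_success (E := E) hP hTe hT hTp hbyz
  obtain ⟨v, hv⟩ : ∃ v, v ∉ byz := ⟨u, hu⟩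
  have hspread : ∀ {r' w j}, w ∉ byz → (E.state j w).HasCommitted r' → ∀ u, u ∉ byz →
      ∃ j, (E.state j u).HasCommitted r' := by
    rintro r' w j hw ⟨d, hd, hr'⟩ u hu
    have hent : ∀ N, ∃ e ≥ N, ∃ k, (E.state k u).active ∧ (E.state k u).epoch = e := by
      intro N
      obtain ⟨e, ⟨hq, hs⟩, hN⟩ := (((primaryOf_frequently P.f P.g P.perf hP.window v).and_eventually
        hsucc).and_eventually (Filter.eventually_ge_atTop N)).exists
      obtain ⟨k, hk⟩ := (hs (by rw [show P.primary e = v from hq]; exact hv)).entered u hu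
      exact ⟨e, hN, k, hk⟩
    obtain ⟨j, hj⟩ := exists_mem_certs hu hw hent hd
    exact ⟨j, d, hj, hr'⟩
  by_contra! hno
  replace hno : ∀ w, w ∉ byz → ∀ j, ¬ (E.state j w).HasCommitted r := fun w hw j hj =>
    let ⟨k, hk⟩ := hspread hw hj u hu
    hno k hk
  obtain ⟨k₀, -, hdel, -⟩ := E.client_network i r v hsub hr hv
  have hqueue : r ∈ (E.state (k₀ + 1) v).queue :=
    (E.inv _ v).request _ _ (E.mem_of_deliver (Nat.lt_succ_self k₀) hdel)
  obtain ⟨q₁, q₂, hq⟩ := List.append_of_mem hqueue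
  obtain ⟨N, hN₀, hN⟩ : ∃ N, k₀ + 1 ≤ N ∧ ∀ r' ∈ q₁, (∃ j, (E.state j v).HasCommitted r') →
      (E.state N v).HasCommitted r' := by
    choose! g hg using fun (r' : Request Client Op)
      (h : ∃ j, (E.state j v).HasCommitted r') => h
    refine ⟨max (k₀ + 1) (q₁.toFinset.sup g), le_max_left _ _, fun r' hr' h => ?_⟩
    exact hasCommitted_mono ((Finset.le_sup (List.mem_toFinset.2 hr')).trans (le_max_right _ _))
      (hg r' h)
  set C : ℕ → P.Rep → ℕ := fun e =>
    if h : ∃ cfg, E.IsConfig e cfg then h.choose.load else fun _ => 1 with hC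
  have hCpos : ∀ e w, 1 ≤ C e w := by
    intro e w
    simp only [hC]
    split_ifs with h
    · exact h.choose_spec.sound.load_pos hP w
    · exact le_rfl
  obtain ⟨S, hS, hfreq⟩ := hP.rotation.rotates C hCpos v (P.hash r.client)
  obtain ⟨p, hpS, hp⟩ := exists_correct hbyz hS
  obtain ⟨e, ⟨⟨hpe, hrot⟩, hs⟩, hlate⟩ := (((hfreq p hpS).and_eventually hsucc).and_eventually
    (Filter.eventually_gt_atTop (E.state N v).epoch)).exists
  replace hs := hs (by rw [hpe]; exact hp)
  obtain ⟨k, hka, hke⟩ := hs.entered v hv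
  have hcfg : E.IsConfig e (E.state k v).cfg := ⟨k, v, hv, hka, hke, rfl⟩
  generalize (E.state k v).cfg = cfg at hcfg
  have hbucket : cfg.bucket (P.hash r.client) = v := by
    have hex : ∃ cfg, E.IsConfig e cfg := ⟨cfg, hcfg⟩
    rw [hcfg.sound.bucket_eq, ← hrot]
    simp only [hC, dif_pos hex]
    rw [IsConfig.unique hbyz hex.choose_spec hcfg]
  have hhang : ∀ x, cfg.hang x ≠ some (some r) := by
    intro x hx
    have hmem := hcfg.sound.hang_mem hx
    rw [hbucket] at hmem
    obtain ⟨j, w, hw, y, hy, l, hla, hle, hacc⟩ :=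
      (hs.hang hcfg hv hmem (by simp [hx])).accepted hbyz hcfg hv hmem
    have := (E.inv l v).hang hla x (some r)
      (by rw [IsConfig.unique hbyz ⟨l, v, hv, hla, hle, rfl⟩ hcfg, hx])
    rw [hacc, Option.some.injEq] at this
    exact hno w hw j ⟨_, hy, this⟩
  have hlater : ∀ j, (E.state j v).epoch = e → N ≤ j := by
    intro j hj
    by_contra! hlt
    have := E.epoch_mono hlt.le v
    omega
  have hq' : ∀ j, N ≤ j → ∃ q₂', (E.state j v).queue = q₁ ++ r :: q₂' := by
    intro j hj
    obtain ⟨l, hl⟩ := (E.evolves (hN₀.trans hj) v).queue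
    exact ⟨q₂ ++ l, by rw [← hl, hq]; simp⟩
  obtain ⟨l₁, sn, l₂, hown, hl₁, hsn⟩ := hcfg.sound.own_split v
  have hel : ∀ j, (E.state j v).active → (E.state j v).epoch = e → ¬ (E.state j v).Used sn →
      (E.state j v).Eligible v r := fun j ha hep hu =>
    eligible_of_fresh hbyz hcfg hv hown hl₁ hbucket hhang ha hep hu (hno v hv j)
  have hmem : sn ∈ cfg.own v := by rw [hown]; simp
  rcases hs.fresh hcfg hv hown hl₁ hsn with hcert | ⟨j, ha, hep, hfresh, hnone⟩
  · obtain ⟨j, w, hw, x, hx, l, hla, hle, hacc⟩ := hcert.accepted hbyz hcfg hv hmem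
    obtain ⟨r', rfl, l', -, hla', hle', hprop⟩ :=
      proposed_of_accepted hbyz hcfg hv hv hmem hsn hla hle hacc
    obtain ⟨o, -, hoe, ho⟩ := proposed_origin hla' hprop
    have hoe' := hoe.trans hle'
    obtain ⟨a, b, hab, ha⟩ := ho.first
    obtain ⟨q₂', hq₂'⟩ := hq' o (hlater o hoe')
    rcases mem_of_append_cons_eq (hab.symm.trans hq₂') with h | rfl | h
    · obtain ⟨j', hj'⟩ := hspread hw ⟨_, hx, rfl⟩ v hv
      exact ho.eligible.2.1 (hasCommitted_mono (hlater o hoe') (hN r' h ⟨j', hj'⟩))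
    · exact hno w hw j ⟨_, hx, rfl⟩
    · exact ha r h (hel o ho.active hoe' ho.fresh)
  · obtain ⟨q₂', hq₂'⟩ := hq' j (hlater j hep)
    exact hnone r (by rw [hq₂']; simp) (hel j ha hep hfresh)

end Execution

end

end FnF

theorem mainTheorem2 :
    ∃ κ : ℝ, 0 < κ ∧
      ∀ (Client Op : Type*) (P : FnF.Protocol Client), P.WellFormed →
        κ * P.Δ ≤ P.Te → κ * P.Δ ≤ P.T → κ * P.Δ ≤ P.Tp →
        ∀ (byz : Finset P.Rep), byz.card ≤ P.f →
        ∀ (good : Set Client) (E : FnF.Execution P Op byz good)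
          (i : ℕ) (r : FnF.Request Client Op), E.event i = .submit r → r.client ∈ good →
        ∀ u ∉ byz, ∃ j, ∀ j' ≥ j, (E.state j' u).HasCommitted r := by
  refine ⟨18, by norm_num, fun Client Op P hP hTe hT hTp byz hbyz good E i r hsub hr u hu => ?_⟩
  obtain ⟨j, hj⟩ := FnF.Execution.exists_hasCommitted hP hTe hT hTp hbyz hsub hr hu
  exact ⟨j, fun j' hj' => FnF.Execution.hasCommitted_mono hj' hj⟩
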